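/- Let two risk processes on a common probability space be given by $$R^j_t=x_j+c_jt-\sum_{k=1}^{N^j_t}Z^j_k,\qquad t\ge 0,\ j=1,2,$$ where $x_j\ge 0$, $c_j>0$, $(N^j_t)_{t\ge 0}$ is a Poisson process of intensity $\alpha_j>0$, and $(Z^j_k)_{k\ge 1}$ is an i.i.d. sequence of non-negative random variables with finite mean $m^j$ that is independent of $(N^j_t)_{t\ge0}$. Suppose $c_j-\alpha_jm^j>0$. No independence between the processes $R^1$ and $R^2$ is assumed. Put $$\psi_{\mathrm{or}}(x_1,x_2)=\mathbb P\Big(\inf_{t\ge 0}R^1_t<0\ \text{ or }\ \inf_{t\ge 0}R^2_t<0\Big).$$ For $j=1,2$ write $Z^j=Z^j_1$, let $\kappa_j>0$ be the solution of $\int_0^\infty e^{\kappa_j y}\frac{\alpha_j}{c_j}\mathbb P(Z^j>y)\,dy=1$, and let $$g_j(z)=\int_0^\infty e^{(\kappa_j+z)y}\,\frac{\alpha_j}{c_j}\,\mathbb P(Z^j>y)\,dy .$$ Suppose that for some $r_j>0$ one has $\mathbb E[e^{sZ^j}]<\infty$ for all $s<\kappa_j+r_j$ (for instance, all exponential moments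 are finite), and that the solutions of $g_j(z)=1$ in $\{z\in\mathbb C:0\le \Re z<r_j\}$ are exactly $0$, $z_1^j$, $\overline{z_1^j}$, where $z_1^j\ne 0$ and $g_j'(z_1^j)\neq 0$. Set $$C_0^j=\frac{c_j-\alpha_jm^j}{\alpha_j\mathbb E[Z^je^{\kappa_jZ^j}]-c_j},\qquad C_1^j=\frac{2\,(c_j-\alpha_jm^j)}{\alpha_j\mathbb E[Z^je^{(\kappa_j+z_1^j)Z^j}]-c_j},$$ the coefficients of the two-term expansion of the ruin probability of company $j$. Let $q>0$ with $q\kappa_2\ne\kappa_1$, and consider the four functions of $x$ $$\Re[C_0^1e^{-\kappa_1x}],\quad \Re[C_1^1e^{-(\kappa_1+z_1^1)x}],\quad \Re[C_0^2e^{-q\kappa_2x}],\quad \Re[C_1^2e^{-q(\kappa_2+z_1^2)x}].$$ Then two different ones among them, $\Re[D_0e^{-d_0x}]$ and $\Re[D_1e^{-d_1x}]$ (with $D_0,d_0,D_1,d_1$ the corresponding coefficients and exponents), are the two dominant ones, in the sense that $d_0$ is real, $0<d_0<\Re(d_1)$, and $\Re(d_1)$ is at most the real part of each of the two remaining exponents;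 and $$\psi_{\mathrm{or}}(x,qx)=\Re[D_0e^{-d_0x}]+\Re[D_1e^{-d_1x}]+\eta_q(x)e^{-\Re(d_1)x},\qquad x\ge 0,$$ for a function $\eta_q$ with $0\le\limsup_{x\to\infty}|\eta_q(x)|\le 1$. (If $\Re(d_1)$ is equal to the real part of a remaining exponent, this is asserted for at least one choice of $D_1,d_1$.) -/

import Mathlib

open MeasureTheory ProbabilityTheory Filter Topology
open scoped NNReal ENNReal ComplexConjugate

noncomputable section

/-- `N` is a (homogeneous) Poisson process with intensity `α`: it counts arrivals whose
interarrival times `T 0, T 1, …` are i.i.d. exponential with parameter `α`, so that almost surely,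
for all `t` and `n`, one has `N t ≥ n` iff the `n`-th arrival time `T 0 + ⋯ + T (n - 1)` is `≤ t`. -/
structure IsPoissonProcess {Ω : Type*} [MeasurableSpace Ω] (P : Measure Ω) (α : ℝ)
    (N : ℝ≥0 → Ω → ℕ) : Prop where
  intensity_pos : 0 < α
  measurable : ∀ t, Measurable (N t)
  exists_interarrival : ∃ T : ℕ → Ω → ℝ,
    (∀ n, Measurable (T n)) ∧ iIndepFun T P ∧ (∀ n, P.map (T n) = expMeasure α) ∧
    ∀ᵐ ω ∂P, ∀ (t : ℝ≥0) (n : ℕ), n ≤ N t ω ↔ ∑ k ∈ Finset.range n, T k ω ≤ (t : ℝ)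

/-- The data of a compound Poisson (Cramér–Lundberg) risk process with premium rate `c`, claim
counting process `N` of intensity `α`, and claims `Z 0, Z 1, …`. -/
structure IsRiskModel {Ω : Type*} [MeasurableSpace Ω] (P : Measure Ω) (α c : ℝ)
    (N : ℝ≥0 → Ω → ℕ) (Z : ℕ → Ω → ℝ) : Prop where
  premium_pos : 0 < c
  poisson : IsPoissonProcess P α N
  claim_measurable : ∀ k, Measurable (Z k)
  claim_iIndep : iIndepFun Z P
  claim_identDistrib : ∀ k, IdentDistrib (Z k) (Z 0) P P
  claim_nonneg : ∀ k, ∀ᵐ ω ∂P, 0 ≤ Z k ω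
  claim_integrable : Integrable (Z 0) P
  /-- The claim counting process is independent of the sequence of claims. -/
  indep : IndepFun (fun ω t => N t ω) (fun ω k => Z k ω) P
  /-- Positive safety loading: the mean drift `c - α m` is positive. -/
  drift_pos : 0 < c - α * ∫ ω, Z 0 ω ∂P

/-- The capital `R_t = x + c t - ∑_{k ≤ N_t} Z_k` at time `t`. -/
def riskProcess {Ω : Type*} (c x : ℝ) (N : ℝ≥0 → Ω → ℕ) (Z : ℕ → Ω → ℝ)
    (t : ℝ≥0) (ω : Ω) : ℝ :=
  x + c * t - ∑ k ∈ Finset.range (N t ω), Z k ω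

/-- Eventual ruin: `inf_{t ≥ 0} R_t < 0` (the infimum is taken in the extended reals, as the
path may be unbounded below on a null set). -/
def IsRuined {Ω : Type*} (c x : ℝ) (N : ℝ≥0 → Ω → ℕ) (Z : ℕ → Ω → ℝ) (ω : Ω) : Prop :=
  (⨅ t : ℝ≥0, ((riskProcess c x N Z t ω : ℝ) : EReal)) < 0

/-- The probability that at least one of the two companies is eventually ruined, when the initial
reserves are `x₁` and `x₂`. -/
def ruinProbOr {Ω : Type*} [MeasurableSpace Ω] (P : Measure Ω) (c : Fin 2 → ℝ)
    (N : Fin 2 → ℝ≥0 → Ω → ℕ) (Z : Fin 2 → ℕ → Ω → ℝ) (x₁ x₂ : ℝ) : ℝ :=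
  P.real {ω | IsRuined (c 0) x₁ (N 0) (Z 0) ω ∨ IsRuined (c 1) x₂ (N 1) (Z 1) ω}

/-- The function `z ↦ ∫_0^∞ e^{z y} (α / c) P(ζ > y) dy` of the Lundberg equation, for a
claim size `ζ`. -/
def lundbergTransform {Ω : Type*} [MeasurableSpace Ω] (P : Measure Ω) (α c : ℝ) (ζ : Ω → ℝ)
    (z : ℂ) : ℂ :=
  ∫ y in Set.Ioi (0 : ℝ), Complex.exp (z * y) * ((α / c * P.real {ω | y < ζ ω} : ℝ) : ℂ)

/-- The moment generating function `g` of the probability measure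
`F(dy) = e^{κ y} (α / c) P(ζ > y) dy` on `(0, ∞)`. -/
def tiltedMGF {Ω : Type*} [MeasurableSpace Ω] (P : Measure Ω) (α c : ℝ) (ζ : Ω → ℝ) (κ : ℝ)
    (z : ℂ) : ℂ :=
  lundbergTransform P α c ζ (κ + z)

/-- The number `(c - α m) / (α E[ζ e^{w ζ}] - c)`, with `m = E[ζ]`. -/
def ruinResidue {Ω : Type*} [MeasurableSpace Ω] (P : Measure Ω) (α c : ℝ) (ζ : Ω → ℝ)
    (w : ℂ) : ℂ :=
  ((c - α * ∫ ω, ζ ω ∂P : ℝ) : ℂ) /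
    (α * (∫ ω, (ζ ω : ℂ) * Complex.exp (w * ζ ω) ∂P) - c)

/-- The exponents `κ` (index `0`) and `κ + z₁` (index `1`) of the two-term expansion of a
one-dimensional ruin probability. -/
def ruinExponent (κ : ℝ) (z₁ : ℂ) : Fin 2 → ℂ :=
  ![(κ : ℂ), κ + z₁]

/-- The coefficients of `e^{-κ x}` and of `e^{-(κ + z₁) x}` in the two-term expansion
`Re[C₀ e^{-κ x}] + Re[C₁ e^{-(κ + z₁) x}]` of a one-dimensional ruin probability.
The factor `2` in `C₁` collects the contributions of the conjugate roots `z₁` and `conj z₁`. -/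
def ruinCoeff {Ω : Type*} [MeasurableSpace Ω] (P : Measure Ω) (α c : ℝ) (ζ : Ω → ℝ) (κ : ℝ)
    (z₁ : ℂ) : Fin 2 → ℂ :=
  ![ruinResidue P α c ζ κ, 2 * ruinResidue P α c ζ (κ + z₁)]

/-- Along the direction `(x₁, x₂) = (x, q x)`, the exponent in `x` of term `i.2` of company `i.1`:
`κ₁`, `κ₁ + z₁¹` for the first company and `q κ₂`, `q (κ₂ + z₁²)` for the second one. -/
def dirExponent (q : ℝ) (κ : Fin 2 → ℝ) (z₁ : Fin 2 → ℂ) (i : Fin 2 × Fin 2) : ℂ :=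
  (![(1 : ℂ), (q : ℂ)] i.1) * ruinExponent (κ i.1) (z₁ i.1) i.2

/-- The coefficient of term `i.2` of company `i.1`. -/
def dirCoeff {Ω : Type*} [MeasurableSpace Ω] (P : Measure Ω) (α c : Fin 2 → ℝ)
    (Z : Fin 2 → ℕ → Ω → ℝ) (κ : Fin 2 → ℝ) (z₁ : Fin 2 → ℂ) (i : Fin 2 × Fin 2) : ℂ :=
  ruinCoeff P (α i.1) (c i.1) (Z i.1 0) (κ i.1) (z₁ i.1) i.2

end

/-! By inclusion-exclusion the probability that at least one company is ruined is ψ₁(x) + ψ₂(qx)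
minus the probability that both are. The subtracted term lies between 0 and either one-dimensional
ruin probability, and nothing else about the dependence is used. Let j be the company with the
smaller leading exponent e, let j' be the other one with leading exponent e', and let f be the real
part of the second exponent of j. If f ≤ e', both terms of j are kept; the remainder is, up to
faster decay, ψ_{j'} minus the intersection, a number in [0, ψ_{j'}]. If e' < f, the leading terms
of both companies are kept and the remainder is, up to faster decay, minus the intersection. In both
cases |η| is asymptotically at most the leading coefficient of j', and that coefficient is at most 1
by the convexity of exp (`two_mul_exp_sub_one_le`, `exists_ruinResidue_adjustment`).

The one-dimensional expansion is `exists_abs_ruin_sub_le`. Put β = α/c, D(u) = u - β(E e^{uζ} - 1),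
and let φ be the survival probability. Conditioning on the first claim gives φ(x) = E φ(x + cT - Z),
whose transform reads D(u) ∫₀^∞ e^{ux} φ(x) dx = -φ(0) for -β < Re u < 0. Letting u tend to 0 yields
φ(0) = D'(0) = 1 - βm. Hence 1 - φ has transform -1/u + φ(0)/D(u), which is meromorphic for Re u < κ
+ r. Since D(u) = u (1 - `lundbergTransform`), the assumption on the roots says that its only poles
are κ, κ + z₁ and the conjugate of the latter, all simple; the singularity at 0 cancels. Fourier
inversion and a shift of the contour across these poles (`exists_norm_sub_sum_le_of_laplace`) turn
the residues into the terms of the expansion.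

Ruin can occur only at claim times (`isRuined_iff`), so ψ = 1 - φ, where φ is defined through a
random walk with independent steps on a product space. -/

/-! ### Complex analysis: exponential expansions from Laplace transforms -/

/-- Simultaneous removal of finitely many singularities. -/
theorem exists_differentiableOn_of_tendsto_sub_mul {U : Set ℂ} (hU : IsOpen U) (S : Finset ℂ) :
    ∀ f : ℂ → ℂ, DifferentiableOn ℂ f (U \ S) →
      (∀ p ∈ S, Tendsto (fun u => (u - p) * f u) (𝓝[≠] p) (𝓝 0)) →
      ∃ g : ℂ → ℂ, DifferentiableOn ℂ g U ∧ ∀ u, u ∉ S → g u = f u := by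
  classical
  induction S using Finset.induction_on with
  | empty => intro f hf _; exact ⟨f, by simpa using hf, fun _ _ => rfl⟩
  | insert p S hp ih =>
    intro f hf h
    by_cases hpU : p ∈ U
    · have hmem : U \ (S : Set ℂ) ∈ 𝓝 p :=
        (hU.sdiff S.finite_toSet.isClosed).mem_nhds ⟨hpU, by simpa using hp⟩
      -- The removability criterion concerns f - f p. The value f p is arbitrary, and its
      -- contribution (u - p) * f p vanishes in the limit.
      have hlim : Tendsto (fun u : ℂ => (u - p) * f p) (𝓝[≠] p) (𝓝 0) := by
        have : Continuous (fun u : ℂ => (u - p) * f p) := by fun_prop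
        simpa using (this.tendsto p).mono_left nhdsWithin_le_nhds
      have ho : (fun z => f z - f p) =o[𝓝[≠] p] fun z => (z - p)⁻¹ := by
        refine Asymptotics.isLittleO_of_tendsto' ?_ ?_
        · filter_upwards [self_mem_nhdsWithin] with z hz h0
          exact absurd (sub_eq_zero.1 (inv_eq_zero.1 h0)) hz
        · have := (h p (by simp)).sub hlim
          rw [sub_zero] at this
          refine this.congr fun z => ?_
          rw [div_inv_eq_mul]; ring
      have hd := Complex.differentiableOn_update_limUnder_of_isLittleO hmem
        (hf.mono fun z hz => ⟨hz.1.1, by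
          simpa using ⟨hz.2, by simpa using hz.1.2⟩⟩) ho
      obtain ⟨g, hg, hgf⟩ := ih _ hd (fun p' hp' => by
        have hne : p' ≠ p := fun e => hp (e ▸ hp')
        refine (h p' (by simp [hp'])).congr' ?_
        have : ∀ᶠ z in 𝓝[≠] p', z ≠ p := nhdsWithin_le_nhds (isOpen_ne.mem_nhds hne)
        filter_upwards [this] with z hz
        rw [Function.update_of_ne hz])
      refine ⟨g, hg, fun u hu => ?_⟩
      simp only [Finset.mem_insert, not_or] at hu
      rw [hgf u hu.2, Function.update_of_ne hu.1]
    · obtain ⟨g, hg, hgf⟩ := ih f (hf.mono fun z hz => ⟨hz.1, by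
        have : z ≠ p := fun e => hpU (e ▸ hz.1)
        simpa using ⟨this, by simpa using hz.2⟩⟩) (fun p' hp' => h p' (by simp [hp']))
      exact ⟨g, hg, fun u hu => hgf u fun hS => hu (by simp [hS])⟩

theorem integrable_of_norm_le_inv_one_add_sq {f : ℝ → ℂ} (hf : Continuous f) {K T : ℝ}
    (hK : ∀ t, T ≤ |t| → ‖f t‖ ≤ K * (1 + t ^ 2)⁻¹) : Integrable f := by
  have hpos : ∀ t : ℝ, 0 < (1 + t ^ 2)⁻¹ := fun t => by positivity
  refine hf.locallyIntegrable.integrable_of_isBigO_atBot_atTop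
    (g := fun t => (1 + t ^ 2)⁻¹) (g' := fun t => (1 + t ^ 2)⁻¹) ?_ ?_ ?_ ?_
  · refine Asymptotics.IsBigO.of_bound K ?_
    filter_upwards [eventually_le_atBot (-T)] with t ht
    rw [Real.norm_of_nonneg (hpos t).le]
    exact hK t (by rw [le_abs]; right; linarith)
  · exact integrable_inv_one_add_sq.integrableAtFilter _
  · refine Asymptotics.IsBigO.of_bound K ?_
    filter_upwards [eventually_ge_atTop T] with t ht
    rw [Real.norm_of_nonneg (hpos t).le]
    exact hK t (by rw [le_abs]; left; linarith)
  · exact integrable_inv_one_add_sq.integrableAtFilter _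

theorem continuous_verticalLine {f : ℂ → ℂ} {a b : ℝ}
    (hf : ContinuousOn f {u | a ≤ u.re ∧ u.re ≤ b}) {s : ℝ} (h1 : a ≤ s) (h2 : s ≤ b) :
    Continuous (fun t : ℝ => f (s + t * Complex.I)) :=
  hf.comp_continuous (by fun_prop) fun t => by simp [h1, h2]

/-- Shifting the line of integration of a function that decays quadratically in a strip. -/
theorem integral_verticalLine_eq {f : ℂ → ℂ} {a b K T : ℝ} (hab : a ≤ b)
    (hf : DifferentiableOn ℂ f {u | a ≤ u.re ∧ u.re ≤ b})
    (hK : ∀ u : ℂ, a ≤ u.re → u.re ≤ b → T ≤ |u.im| → ‖f u‖ ≤ K * (1 + u.im ^ 2)⁻¹) :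
    ∫ t : ℝ, f (a + t * Complex.I) = ∫ t : ℝ, f (b + t * Complex.I) := by
  have hint : ∀ s, a ≤ s → s ≤ b → Integrable (fun t : ℝ => f (s + t * Complex.I)) :=
    fun s h1 h2 => integrable_of_norm_le_inv_one_add_sq (continuous_verticalLine hf.continuousOn h1 h2)
      (K := K) (T := T) fun t ht => by simpa using hK (s + t * Complex.I) (by simpa) (by simpa) (by simpa)
  have ha := intervalIntegral_tendsto_integral (hint a le_rfl hab) tendsto_neg_atTop_atBot tendsto_id
  have hb := intervalIntegral_tendsto_integral (hint b hab le_rfl) tendsto_neg_atTop_atBot tendsto_id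
  have hz : Tendsto (fun y : ℝ => (b - a) * (K * (1 + y ^ 2)⁻¹)) atTop (𝓝 0) := by
    have : Tendsto (fun y : ℝ => 1 + y ^ 2) atTop atTop :=
      tendsto_atTop_add_const_left _ _ (tendsto_pow_atTop two_ne_zero)
    simpa using (this.inv_tendsto_atTop.const_mul K).const_mul (b - a)
  have hedge : ∀ y : ℝ, T ≤ |y| →
      ‖∫ x : ℝ in a..b, f (x + y * Complex.I)‖ ≤ (b - a) * (K * (1 + y ^ 2)⁻¹) := fun y hy => by
    have := intervalIntegral.norm_integral_le_of_norm_le_const (a := a) (b := b)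
      (f := fun x : ℝ => f (x + y * Complex.I)) (C := K * (1 + y ^ 2)⁻¹) (fun x hx => by
        rw [Set.uIoc_of_le hab] at hx
        simpa using hK (x + y * Complex.I) (by simpa using hx.1.le) (by simpa using hx.2) (by simpa))
    rw [abs_of_nonneg (sub_nonneg.2 hab)] at this
    linarith
  have hrect : ∀ y : ℝ, (∫ x : ℝ in a..b, f (x + (-y : ℝ) * Complex.I)) -
      (∫ x : ℝ in a..b, f (x + y * Complex.I)) +
      Complex.I • (∫ t : ℝ in -y..y, f (b + t * Complex.I)) -
      Complex.I • (∫ t : ℝ in -y..y, f (a + t * Complex.I)) = 0 := fun y => by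
    have := Complex.integral_boundary_rect_eq_zero_of_differentiableOn f
      (⟨a, -y⟩ : ℂ) (⟨b, y⟩ : ℂ) (hf.mono fun u hu => by
        have := hu.1
        simp only [Set.mem_preimage, Set.uIcc_of_le hab] at this
        exact this)
    simpa using this
  have hsum : Tendsto (fun y : ℝ => (∫ t : ℝ in -y..y, f (b + t * Complex.I)) -
      (∫ t : ℝ in -y..y, f (a + t * Complex.I))) atTop (𝓝 0) := by
    refine squeeze_zero_norm' ?_ (by simpa using hz.add hz)
    filter_upwards [eventually_ge_atTop T] with y hy
    have h1 := hedge y (hy.trans (le_abs_self y))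
    have h2 := hedge (-y) (by rw [abs_neg]; exact hy.trans (le_abs_self y))
    rw [neg_sq] at h2
    have e : Complex.I • ((∫ t : ℝ in -y..y, f (b + t * Complex.I)) -
      (∫ t : ℝ in -y..y, f (a + t * Complex.I))) = (∫ x : ℝ in a..b, f (x + y * Complex.I)) -
        ∫ x : ℝ in a..b, f (x + (-y : ℝ) * Complex.I) := by
      rw [smul_sub]; linear_combination hrect y
    have e' := congrArg norm e
    rw [norm_smul, Complex.norm_I, one_mul] at e'
    rw [e']
    exact (norm_sub_le _ _).trans (add_le_add h1 h2)
  exact (sub_eq_zero.1 (tendsto_nhds_unique (hb.sub ha) hsum)).symm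

/-- A continuous function on the half-line whose Laplace transform extends to a strip, with
quadratic decay, is exponentially small. -/
theorem exists_norm_le_exp_of_laplace {v : ℝ → ℂ} (hv : ContinuousOn v (Set.Ici 0)) (hv0 : v 0 = 0)
    {B : ℝ} (hB : ∀ x, 0 ≤ x → ‖v x‖ ≤ B) {σ b K T : ℝ} (hσ : 0 < σ) (hb : 0 ≤ b) {V : ℂ → ℂ}
    (hV : DifferentiableOn ℂ V {u | -σ ≤ u.re ∧ u.re ≤ b})
    (hK : ∀ u : ℂ, -σ ≤ u.re → u.re ≤ b → T ≤ |u.im| → ‖V u‖ ≤ K * (1 + u.im ^ 2)⁻¹)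
    (htr : ∀ t : ℝ, ∫ x : ℝ in Set.Ioi 0, Complex.exp ((-σ + t * Complex.I) * x) * v x =
      V (-σ + t * Complex.I)) :
    ∃ K' : ℝ, ∀ x, 0 ≤ x → ‖v x‖ ≤ K' * Real.exp (-b * x) := by
  -- The damping factor makes the merely bounded v integrable, and v 0 = 0 makes the extension by
  -- zero continuous, as pointwise Fourier inversion requires.
  set F : ℝ → ℂ := Set.indicator (Set.Ici 0) (fun x => Complex.exp (-σ * x) * v x) with hF
  have hσb : -σ ≤ b := by linarith
  have hFc : Continuous F := by
    refine continuous_indicator (fun x hx => ?_) ?_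
    · rw [frontier_Ici] at hx
      rw [Set.mem_singleton_iff.1 hx, hv0, mul_zero]
    · rw [isClosed_Ici.closure_eq]
      exact ContinuousOn.mul (by fun_prop) hv
  have hFi : Integrable F := by
    rw [hF, integrable_indicator_iff measurableSet_Ici, integrableOn_Ici_iff_integrableOn_Ioi]
    refine Integrable.mono' (g := fun x => B * Real.exp (-σ * x))
      ((integrableOn_exp_mul_Ioi (by linarith) 0).const_mul B) ?_ ?_
    · exact (ContinuousOn.mul (by fun_prop) (hv.mono Set.Ioi_subset_Ici_self)).aestronglyMeasurable
        measurableSet_Ioi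
    · filter_upwards [ae_restrict_mem measurableSet_Ioi] with x hx
      rw [norm_mul, Complex.norm_exp, mul_comm]
      have : ((-σ * x : ℂ)).re = -σ * x := by simp
      rw [this]
      exact mul_le_mul_of_nonneg_right (hB x (le_of_lt hx)) (Real.exp_pos _).le
  have hFT : ∀ w : ℝ, FourierTransform.fourier F w = V (-σ + ((-(2 * Real.pi) * w : ℝ)) * Complex.I) := fun w => by
    rw [Real.fourier_eq', ← htr]
    rw [← integral_Ici_eq_integral_Ioi, ← integral_indicator measurableSet_Ici]
    congr 1
    ext x
    by_cases hx : x ∈ Set.Ici (0 : ℝ)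
    · rw [hF, Set.indicator_of_mem hx, Set.indicator_of_mem hx, smul_eq_mul, ← mul_assoc, ← Complex.exp_add]
      congr 2
      simp
      ring
    · rw [hF, Set.indicator_of_notMem hx, Set.indicator_of_notMem hx, smul_zero]
  have hvert := continuous_verticalLine hV.continuousOn le_rfl hσb
  push_cast at hvert
  have hFTi : Integrable (FourierTransform.fourier F) := by
    have h1 : Integrable (fun t : ℝ => V (-σ + t * Complex.I)) := by
      refine integrable_of_norm_le_inv_one_add_sq hvert (K := K) (T := T) fun t ht => ?_
      simpa using hK (-σ + t * Complex.I) (by simp) (by simpa) (by simpa)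
    have h2 := h1.comp_mul_left' (R := -(2 * Real.pi)) (by simp [Real.pi_ne_zero])
    exact h2.congr (Eventually.of_forall fun w => by rw [hFT])
  have hinv := hFc.fourierInv_fourier_eq hFi hFTi
  -- The prefactor is the Jacobian of t = -2πw, which passes from the Fourier variable to the height
  -- on the vertical line.
  refine ⟨|(-(2 * Real.pi))⁻¹| * ∫ t : ℝ, ‖V (b + t * Complex.I)‖, fun x hx => ?_⟩
  have key : v x = |(-(2 * Real.pi))⁻¹| • ∫ t : ℝ,
      Complex.exp (-(b + t * Complex.I) * x) * V (b + t * Complex.I) := by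
    have e1 : v x = Complex.exp (σ * x) * F x := by
      rw [hF, Set.indicator_of_mem (show x ∈ Set.Ici (0:ℝ) from hx), ← mul_assoc, ← Complex.exp_add]
      simp
    have e2 : ∫ t : ℝ, Complex.exp (-(b + t * Complex.I) * x) * V (b + t * Complex.I) =
        ∫ t : ℝ, Complex.exp (-((-σ : ℝ) + t * Complex.I) * x) * V ((-σ : ℝ) + t * Complex.I) := by
      refine (integral_verticalLine_eq (f := fun u => Complex.exp (-u * x) * V u) (K := Real.exp (σ * x) * K)
        (T := T) hσb (DifferentiableOn.mul (by fun_prop) hV) fun u h1 h2 h3 => ?_).symm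
      rw [norm_mul, Complex.norm_exp, mul_assoc]
      refine mul_le_mul (Real.exp_le_exp.2 ?_) (hK u h1 h2 h3) (norm_nonneg _) (Real.exp_pos _).le
      simp
      nlinarith
    rw [e1, e2, ← hinv, Real.fourierInv_eq', ← Measure.integral_comp_mul_left, ← integral_const_mul]
    congr 1
    ext w
    rw [hFT, smul_eq_mul, ← mul_assoc, ← Complex.exp_add]
    push_cast
    congr 2
    simp
    ring
  rw [key, norm_smul, Real.norm_of_nonneg (abs_nonneg _), mul_assoc]
  refine mul_le_mul_of_nonneg_left ?_ (abs_nonneg _)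
  refine (norm_integral_le_integral_norm _).trans_eq ?_
  rw [mul_comm, ← integral_const_mul]
  congr 1
  ext t
  rw [norm_mul, Complex.norm_exp]
  simp

theorem integrableOn_cexp_mul {f : ℝ → ℂ} (hf : ContinuousOn f (Set.Ici 0))
    {B : ℝ} (hB : ∀ x, 0 ≤ x → ‖f x‖ ≤ B) {u : ℂ} (hu : u.re < 0) :
    IntegrableOn (fun x : ℝ => Complex.exp (u * x) * f x) (Set.Ioi 0) := by
  refine Integrable.mono' (g := fun x => B * Real.exp (u.re * x))
    ((integrableOn_exp_mul_Ioi hu 0).const_mul B) ?_ ?_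
  · exact (ContinuousOn.mul (by fun_prop) (hf.mono Set.Ioi_subset_Ici_self)).aestronglyMeasurable
      measurableSet_Ioi
  · filter_upwards [ae_restrict_mem measurableSet_Ioi] with x hx
    rw [norm_mul, Complex.norm_exp, mul_comm]
    have : ((u * x : ℂ)).re = u.re * x := by simp
    rw [this]
    exact mul_le_mul_of_nonneg_right (hB x (le_of_lt hx)) (Real.exp_pos _).le

theorem integral_cexp_mul_cexp_neg {u p : ℂ} (h : u.re < p.re) :
    ∫ x : ℝ in Set.Ioi 0, Complex.exp (u * x) * Complex.exp (-p * x) = -(u - p)⁻¹ := by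
  have h' : (u - p).re < 0 := by simpa using h
  have := integral_exp_mul_complex_Ioi h' 0
  simp only [Complex.ofReal_zero, mul_zero, Complex.exp_zero] at this
  rw [← one_div, ← neg_div, ← this]
  congr 1
  ext x
  rw [← Complex.exp_add]
  ring_nf

/-- `1/(u-p) - 1/u` decays quadratically in vertical strips. -/
theorem norm_inv_sub_sub_inv_le {u p : ℂ} (h : 2 * ‖p‖ + 1 ≤ |u.im|) :
    ‖(u - p)⁻¹ - u⁻¹‖ ≤ 4 * ‖p‖ * (1 + u.im ^ 2)⁻¹ := by
  have hu := Complex.abs_im_le_norm u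
  have hp := norm_nonneg p
  have h1 : |u.im| / 2 ≤ ‖u - p‖ := by
    have := norm_sub_norm_le u p
    linarith
  have h0 : 1 ≤ |u.im| := by linarith
  have hup : u - p ≠ 0 := norm_pos_iff.1 (by linarith)
  have hu0 : u ≠ 0 := norm_pos_iff.1 (by linarith)
  rw [inv_sub_inv hup hu0, sub_sub_cancel, norm_div, norm_mul, ← div_eq_mul_inv]
  have hpos : 0 < ‖u - p‖ * ‖u‖ := mul_pos (by linarith) (by linarith)
  rw [div_le_div_iff₀ hpos (by positivity)]
  have h2 : |u.im| / 2 * |u.im| ≤ ‖u - p‖ * ‖u‖ := mul_le_mul h1 hu (by linarith) (norm_nonneg _)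
  have h3 : u.im ^ 2 = |u.im| ^ 2 := (sq_abs _).symm
  have h4 : 1 + u.im ^ 2 ≤ 4 * (‖u - p‖ * ‖u‖) := by nlinarith
  calc ‖p‖ * (1 + u.im ^ 2) ≤ ‖p‖ * (4 * (‖u - p‖ * ‖u‖)) := mul_le_mul_of_nonneg_left h4 hp
    _ = _ := by ring

/-- Exponential expansion of a bounded continuous function whose Laplace transform continues
meromorphically, with finitely many simple poles, to a larger half-plane. -/
theorem exists_norm_sub_sum_le_of_laplace {f : ℝ → ℂ} (hf : ContinuousOn f (Set.Ici 0))
    {B : ℝ} (hB : ∀ x, 0 ≤ x → ‖f x‖ ≤ B) {σ b R K T : ℝ} (hσ : 0 < σ) (hb : 0 ≤ b) (hbR : b < R)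
    {W : ℂ → ℂ} (S : Finset ℂ) (hS : ∀ p ∈ S, 0 ≤ p.re)
    (hSR : ∀ p ∈ S, p.re < R) (C : ℂ → ℂ)
    (hW : DifferentiableOn ℂ W ({u | u.re < R} \ S))
    (hres : ∀ p ∈ S, Tendsto (fun u => (u - p) * W u) (𝓝[≠] p) (𝓝 (-C p)))
    (hK : ∀ u : ℂ, -σ ≤ u.re → u.re ≤ b → T ≤ |u.im| → ‖W u + f 0 * u⁻¹‖ ≤ K * (1 + u.im ^ 2)⁻¹)
    (htr : ∀ t : ℝ, ∫ x : ℝ in Set.Ioi 0, Complex.exp ((-σ + t * Complex.I) * x) * f x =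
      W (-σ + t * Complex.I)) :
    ∃ K' : ℝ, ∀ x, 0 ≤ x →
      ‖f x - ∑ p ∈ S, C p * Complex.exp (-p * x)‖ ≤ K' * Real.exp (-b * x) := by
  have hR : 0 < R := hb.trans_lt hbR
  -- The subtraction of w e^{-Rx} makes the remainder vanish at 0, so that its transform decays
  -- quadratically and not just like 1/u. As b < R, this correction is absorbed in the error.
  set w : ℂ := f 0 - ∑ p ∈ S, C p with hw
  set V : ℂ → ℂ := fun u => W u + ∑ p ∈ S, C p * (u - p)⁻¹ + w * (u - R)⁻¹ with hVdef
  have hU : IsOpen {u : ℂ | u.re < R} := isOpen_lt Complex.continuous_re continuous_const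
  have hUR : ∀ u : ℂ, u.re < R → u - R ≠ 0 := fun u hu h => by
    rw [sub_eq_zero.1 h] at hu; simp at hu
  have hVd : DifferentiableOn ℂ V ({u | u.re < R} \ S) := by
    refine (hW.add (DifferentiableOn.fun_sum fun p hp => ?_)).add ?_
    · refine DifferentiableOn.const_mul (DifferentiableOn.inv (by fun_prop) fun u hu => ?_) _
      exact sub_ne_zero.2 fun e => hu.2 (by simpa [e] using hp)
    · exact DifferentiableOn.const_mul (DifferentiableOn.inv (by fun_prop) fun u hu => hUR u hu.1) _
  have hterm : ∀ p : ℂ, ∀ g : ℂ → ℂ, ContinuousAt g p →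
      Tendsto (fun u => (u - p) * g u) (𝓝[≠] p) (𝓝 0) := fun p g hg => by
    have : ContinuousAt (fun u => (u - p) * g u) p := by fun_prop
    simpa [ContinuousAt] using this.tendsto.mono_left nhdsWithin_le_nhds
  have hVres : ∀ p ∈ S, Tendsto (fun u => (u - p) * V u) (𝓝[≠] p) (𝓝 0) := fun p hp => by
    have h1 : Tendsto (fun u => ∑ p' ∈ S, (u - p) * (C p' * (u - p')⁻¹)) (𝓝[≠] p)
        (𝓝 (∑ p' ∈ S, if p' = p then C p else 0)) := by
      refine tendsto_finsetSum _ fun p' _ => ?_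
      split_ifs with h
      · subst h
        refine tendsto_const_nhds.congr' ?_
        filter_upwards [self_mem_nhdsWithin] with u hu
        have := sub_ne_zero.2 (show u ≠ p' from hu)
        field_simp
      · exact hterm p _ (continuousAt_const.mul (ContinuousAt.inv₀ (by fun_prop) (sub_ne_zero.2 (Ne.symm h))))
    rw [Finset.sum_ite_eq' S p, if_pos hp] at h1
    have h2 := hterm p (fun u => w * (u - R)⁻¹)
      (continuousAt_const.mul (ContinuousAt.inv₀ (by fun_prop) (hUR p (hSR p hp))))
    have := ((hres p hp).add h1).add h2
    simp only [neg_add_cancel, add_zero] at this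
    refine this.congr fun u => ?_
    rw [hVdef, ← Finset.mul_sum]; ring
  obtain ⟨V', hV'd, hV'⟩ := exists_differentiableOn_of_tendsto_sub_mul hU S V hVd hVres
  set v : ℝ → ℂ := fun x => f x - ∑ p ∈ S, C p * Complex.exp (-p * x) - w * Complex.exp (-R * x) with hv
  have hexp1 : ∀ p : ℂ, 0 ≤ p.re → ∀ x : ℝ, 0 ≤ x → ‖Complex.exp (-p * x)‖ ≤ 1 := fun p hp x hx => by
    rw [Complex.norm_exp, Real.exp_le_one_iff]
    simpa using mul_nonneg hp hx
  -- Above this height |Im u| is at least 2‖p‖ + 1 for every p in S and for p = R, so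
  -- `norm_inv_sub_sub_inv_le` applies to all the fractions and u lies outside S.
  set Tmax : ℝ := |T| + 2 * (∑ p ∈ S, ‖p‖ + R) + 1 with hTmax
  have hpT : ∀ p ∈ S, 2 * ‖p‖ + 1 ≤ Tmax := fun p hp => by
    have := Finset.single_le_sum (f := fun p : ℂ => ‖p‖) (fun p _ => norm_nonneg p) hp
    have := abs_nonneg T
    simp only [hTmax]
    linarith
  have hRT : 2 * ‖(R : ℂ)‖ + 1 ≤ Tmax := by
    have := Finset.sum_nonneg (s := S) (f := fun p : ℂ => ‖p‖) (fun p _ => norm_nonneg p)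
    have := abs_nonneg T
    rw [Complex.norm_of_nonneg hR.le]
    simp only [hTmax]
    linarith
  obtain ⟨K', hK'⟩ := exists_norm_le_exp_of_laplace (v := v) (V := V') (σ := σ) (b := b)
    (B := B + ∑ p ∈ S, ‖C p‖ + ‖w‖)
    (K := K + ∑ p ∈ S, ‖C p‖ * (4 * ‖p‖) + ‖w‖ * (4 * ‖(R : ℂ)‖)) (T := Tmax)
    ((hf.sub (by fun_prop)).sub (by fun_prop)) (by simp [hv, hw]) (fun x hx => by
      refine (norm_sub_le _ _).trans (add_le_add ((norm_sub_le _ _).trans (add_le_add (hB x hx) ?_)) ?_)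
      · refine norm_sum_le_of_le _ fun p hp => ?_
        rw [norm_mul]
        exact mul_le_of_le_one_right (norm_nonneg _) (hexp1 p (hS p hp) x hx)
      · rw [norm_mul]
        exact mul_le_of_le_one_right (norm_nonneg _) (hexp1 R (by simpa using hR.le) x hx))
    hσ hb (hV'd.mono fun u hu => hu.2.trans_lt hbR) (fun u h1 h2 h3 => by
      have huS : u ∉ S := fun h => by
        have := hpT u h
        have := Complex.abs_im_le_norm u
        have := norm_nonneg u
        linarith
      rw [hV' u huS]
      -- By the choice of w, f 0 is the sum of all the coefficients, so one copy of 1/u can be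
      -- distributed over the fractions.
      have e : V u = (W u + f 0 * u⁻¹) + ∑ p ∈ S, C p * ((u - p)⁻¹ - u⁻¹) +
          w * ((u - R)⁻¹ - u⁻¹) := by
        simp only [hVdef, mul_sub, Finset.sum_sub_distrib, ← Finset.sum_mul, hw]
        ring
      have hTT : T ≤ |u.im| := by
        have := Finset.sum_nonneg (s := S) (f := fun p : ℂ => ‖p‖) (fun p _ => norm_nonneg p)
        have := le_abs_self T
        simp only [hTmax] at h3
        linarith
      rw [e, add_mul, add_mul, Finset.sum_mul]
      refine (norm_add_le _ _).trans (add_le_add ((norm_add_le _ _).trans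
        (add_le_add (hK u h1 h2 hTT) ?_)) ?_)
      · refine norm_sum_le_of_le _ fun p hp => ?_
        rw [norm_mul, mul_assoc]
        exact mul_le_mul_of_nonneg_left (norm_inv_sub_sub_inv_le ((hpT p hp).trans h3)) (norm_nonneg _)
      · rw [norm_mul, mul_assoc]
        exact mul_le_mul_of_nonneg_left (norm_inv_sub_sub_inv_le (hRT.trans h3)) (norm_nonneg _))
    (fun t => by
      set u : ℂ := -σ + t * Complex.I with hu
      have hure : u.re = -σ := by simp [hu]
      have huS : u ∉ S := fun h => by
        have := hS u h
        linarith
      have hlt : ∀ p : ℂ, 0 ≤ p.re → u.re < p.re := fun p hp => by linarith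
      have hneg : u.re < 0 := by linarith
      have hi : ∀ p : ℂ, 0 ≤ p.re →
          IntegrableOn (fun x : ℝ => Complex.exp (u * x) * Complex.exp (-p * x)) (Set.Ioi 0) :=
        fun p hp => integrableOn_cexp_mul (by fun_prop) (hexp1 p hp) hneg
      rw [hV' u huS]
      have e : ∀ x : ℝ, Complex.exp (u * x) * v x = Complex.exp (u * x) * f x -
          ∑ p ∈ S, C p * (Complex.exp (u * x) * Complex.exp (-p * x)) -
          w * (Complex.exp (u * x) * Complex.exp (-R * x)) := fun x => by
        simp only [hv, mul_sub, Finset.mul_sum]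
        congr 1
        · congr 1
          exact Finset.sum_congr rfl fun p _ => by ring
        · ring
      simp_rw [e]
      have i1 := integrableOn_cexp_mul hf hB hneg
      have i2 : IntegrableOn (fun x : ℝ => ∑ p ∈ S, C p * (Complex.exp (u * x) * Complex.exp (-p * x)))
        (Set.Ioi 0) := integrable_finsetSum _ fun p hp => (hi p (hS p hp)).const_mul _
      have hR0 : 0 ≤ ((R : ℂ)).re := by simpa using hR.le
      have i12 : IntegrableOn (fun x : ℝ => Complex.exp (u * x) * f x -
        ∑ p ∈ S, C p * (Complex.exp (u * x) * Complex.exp (-p * x))) (Set.Ioi 0) := i1.sub i2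
      rw [integral_sub i12 ((hi R hR0).const_mul _), integral_sub i1 i2, htr,
        integral_finsetSum _ fun p hp => (hi p (hS p hp)).const_mul _, integral_const_mul,
        integral_cexp_mul_cexp_neg (hlt R hR0)]
      have : ∀ p ∈ S, ∫ x : ℝ in Set.Ioi 0, C p * (Complex.exp (u * x) * Complex.exp (-p * x)) =
          - (C p * (u - p)⁻¹) := fun p hp => by
        rw [integral_const_mul, integral_cexp_mul_cexp_neg (hlt p (hS p hp))]; ring
      rw [Finset.sum_congr rfl this, Finset.sum_neg_distrib, hVdef]
      ring)
  refine ⟨K' + ‖w‖, fun x hx => ?_⟩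
  have e : f x - ∑ p ∈ S, C p * Complex.exp (-p * x) = v x + w * Complex.exp (-R * x) := by
    simp [hv]
  rw [e, add_mul]
  refine (norm_add_le _ _).trans (add_le_add (hK' x hx) ?_)
  rw [norm_mul, Complex.norm_exp]
  refine mul_le_mul_of_nonneg_left (Real.exp_le_exp.2 ?_) (norm_nonneg _)
  simp
  nlinarith

/-! ### The random walk at claim times and its survival probability -/

/-- Splitting off the first coordinate of an i.i.d. sequence. -/
theorem measurePreserving_infinitePi_cons (ν : Measure ℝ) [IsProbabilityMeasure ν] :
    MeasurePreserving (fun z : ℕ → ℝ => (z 0, fun n => z (n + 1)))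
      (Measure.infinitePi fun _ : ℕ => ν) (ν.prod (Measure.infinitePi fun _ : ℕ => ν)) := by
  refine ⟨by fun_prop, ?_⟩
  have hind : iIndepFun (fun (i : ℕ) (z : ℕ → ℝ) => z i) (Measure.infinitePi fun _ : ℕ => ν) :=
    iIndepFun_infinitePi (P := fun _ : ℕ => ν) (X := fun _ x => x) (fun _ => measurable_id)
  have h : IndepFun (fun z : ℕ → ℝ => z 0) (fun (z : ℕ → ℝ) (n : ℕ) => z (n + 1))
      (Measure.infinitePi fun _ : ℕ => ν) := by
    have := indep_iSup_of_disjoint (S := {0}) (T := {0}ᶜ)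
      (fun i => (measurable_pi_apply i).comap_le) hind.iIndep disjoint_compl_right
    refine indep_of_indep_of_le_right (indep_of_indep_of_le_left this ?_) ?_
    · exact le_iSup₂_of_le (f := fun (i : ℕ) (_ : i ∈ ({0} : Set ℕ)) =>
        MeasurableSpace.comap (fun z : ℕ → ℝ => z i) inferInstance) 0 rfl le_rfl
    · refine measurable_iff_comap_le.1 (@measurable_pi_lambda (ℕ → ℝ) ℕ (fun _ => ℝ)
        (⨆ i ∈ ({0}ᶜ : Set ℕ), MeasurableSpace.comap (fun z : ℕ → ℝ => z i) inferInstance) _ _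
        fun n => measurable_iff_comap_le.2 ?_)
      exact le_iSup₂_of_le (f := fun (i : ℕ) (_ : i ∈ ({0}ᶜ : Set ℕ)) =>
        MeasurableSpace.comap (fun z : ℕ → ℝ => z i) inferInstance) (n + 1) (by simp) le_rfl
  rw [h.map_prod_eq_prod_map_map (Measurable.aemeasurable (by fun_prop))
      (Measurable.aemeasurable (by fun_prop)), Measure.infinitePi_map_eval,
    Measure.map_infinitePi_infinitePi_of_inj (P := fun _ : ℕ => ν) (add_left_injective 1)]

/-- The interarrival times and claims for which initial capital `x` is never exhausted. -/
def survivalSet (c x : ℝ) : Set ((ℕ → ℝ) × (ℕ → ℝ)) :=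
  {p | ∀ n : ℕ, ∑ k ∈ Finset.range n, (p.2 k - c * p.1 k) ≤ x}

/-- The survival probability with interarrival law `τ`, claim law `ν`, premium rate `c` and
initial capital `x`. -/
noncomputable def survivalProb (τ ν : Measure ℝ) (c x : ℝ) : ℝ :=
  ((Measure.infinitePi fun _ : ℕ => τ).prod (Measure.infinitePi fun _ : ℕ => ν)).real
    (survivalSet c x)

theorem measurableSet_survivalSet (c x : ℝ) : MeasurableSet (survivalSet c x) := by
  rw [survivalSet, Set.ofPred_forall]
  exact MeasurableSet.iInter fun n => measurableSet_le (by fun_prop) (by fun_prop)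

theorem survivalSet_mono (c : ℝ) : Monotone (survivalSet c) :=
  fun _ _ h _ hp n => (hp n).trans h

/-- The empty sum n = 0 forces 0 ≤ x. Survival is thereby extended by 0 to negative capital, which
lets the renewal equation be written with integrals over all claim sizes. -/
theorem survivalSet_of_neg {c x : ℝ} (hx : x < 0) : survivalSet c x = ∅ := by
  ext p
  simp only [survivalSet, Set.mem_ofPred_eq, Set.mem_empty_iff_false, iff_false, not_forall, not_le]
  exact ⟨0, by simpa using hx⟩

/-- The walk restarts after its first step, which only shifts the initial capital. The condition at
n = 0 is lost in the shift and is supplied by 0 ≤ x. -/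
theorem mem_survivalSet_iff {c x : ℝ} (hx : 0 ≤ x) (p : (ℕ → ℝ) × (ℕ → ℝ)) :
    p ∈ survivalSet c x ↔
      ((fun n => p.1 (n + 1)), fun n => p.2 (n + 1)) ∈ survivalSet c (x + c * p.1 0 - p.2 0) := by
  simp only [survivalSet, Set.mem_ofPred_eq]
  constructor
  · intro h n
    have := h (n + 1)
    rw [Finset.sum_range_succ'] at this
    linarith
  · rintro h (_ | n)
    · simpa using hx
    · have := h n
      rw [Finset.sum_range_succ']
      linarith

section

variable {τ ν : Measure ℝ} {c : ℝ}

theorem survivalProb_nonneg (x : ℝ) : 0 ≤ survivalProb τ ν c x := measureReal_nonneg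

theorem survivalProb_of_neg {x : ℝ} (hx : x < 0) : survivalProb τ ν c x = 0 := by
  simp [survivalProb, survivalSet_of_neg hx]

variable [IsProbabilityMeasure τ] [IsProbabilityMeasure ν]

theorem survivalProb_le_one (x : ℝ) : survivalProb τ ν c x ≤ 1 := measureReal_le_one

theorem monotone_survivalProb : Monotone (survivalProb τ ν c) :=
  fun _ _ h => measureReal_mono (survivalSet_mono c h)

/-- Renewal at the first claim. -/
theorem survivalProb_eq_integral {x : ℝ} (hx : 0 ≤ x) :
    survivalProb τ ν c x = ∫ p : ℝ × ℝ, survivalProb τ ν c (x + c * p.1 - p.2) ∂(τ.prod ν) := by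
  set PT := Measure.infinitePi fun _ : ℕ => τ
  set PZ := Measure.infinitePi fun _ : ℕ => ν
  set A : Set ((ℝ × (ℕ → ℝ)) × (ℝ × (ℕ → ℝ))) :=
    {q | (q.1.2, q.2.2) ∈ survivalSet c (x + c * q.1.1 - q.2.1)} with hA
  have hAm : MeasurableSet A := by
    simp only [hA, survivalSet, Set.mem_ofPred_eq]
    rw [Set.ofPred_forall]
    exact MeasurableSet.iInter fun n => measurableSet_le (by fun_prop) (by fun_prop)
  have hpre : survivalSet c x = (Prod.map (fun z : ℕ → ℝ => (z 0, fun n => z (n + 1)))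
      (fun z : ℕ → ℝ => (z 0, fun n => z (n + 1)))) ⁻¹' A := by
    ext p
    rw [mem_survivalSet_iff hx]
    rfl
  have hmp := (measurePreserving_infinitePi_cons τ).prod (measurePreserving_infinitePi_cons ν)
  have hm : Measurable (A.indicator (1 : (ℝ × (ℕ → ℝ)) × (ℝ × (ℕ → ℝ)) → ℝ≥0∞)) := measurable_one.indicator hAm
  have key : (PT.prod PZ) (survivalSet c x) =
      ∫⁻ p : ℝ × ℝ, (PT.prod PZ) (survivalSet c (x + c * p.1 - p.2)) ∂(τ.prod ν) := by
    rw [hpre, hmp.measure_preimage hAm.nullMeasurableSet, ← lintegral_indicator_one hAm]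
    have hme : Measurable fun p : ℝ × ℝ => (PT.prod PZ) (survivalSet c (x + c * p.1 - p.2)) := by
      have : Measurable fun y : ℝ => (PT.prod PZ) (survivalSet c y) :=
        Monotone.measurable fun _ _ h => measure_mono (survivalSet_mono c h)
      exact this.comp (by fun_prop)
    rw [lintegral_prod _ hm.aemeasurable, lintegral_prod _ hme.aemeasurable,
      lintegral_prod _ hm.lintegral_prod_right'.aemeasurable]
    refine lintegral_congr fun t => ?_
    have : ∀ T : ℕ → ℝ, ∫⁻ q : ℝ × (ℕ → ℝ), A.indicator 1 ((t, T), q) ∂(ν.prod PZ) =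
        ∫⁻ z : ℝ, ∫⁻ Z : ℕ → ℝ, A.indicator 1 ((t, T), (z, Z)) ∂PZ ∂ν := fun T =>
      lintegral_prod _ (hm.comp (by fun_prop : Measurable fun q : ℝ × (ℕ → ℝ) =>
        (((t, T), q) : (ℝ × (ℕ → ℝ)) × (ℝ × (ℕ → ℝ))))).aemeasurable
    rw [lintegral_congr this]
    -- One side integrates in the order t, T, z, Z and the other in the order t, z, (T, Z); the
    -- first tail T has to be exchanged with z.
    have hm2 : Measurable fun q : ((ℕ → ℝ) × ℝ) × (ℕ → ℝ) =>
        A.indicator (1 : (ℝ × (ℕ → ℝ)) × (ℝ × (ℕ → ℝ)) → ℝ≥0∞) ((t, q.1.1), (q.1.2, q.2)) :=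
      hm.comp (by fun_prop : Measurable fun q : ((ℕ → ℝ) × ℝ) × (ℕ → ℝ) =>
        (((t, q.1.1), (q.1.2, q.2)) : (ℝ × (ℕ → ℝ)) × (ℝ × (ℕ → ℝ))))
    rw [lintegral_lintegral_swap hm2.lintegral_prod_right'.aemeasurable]
    refine lintegral_congr fun z => ?_
    have hms := measurableSet_survivalSet c (x + c * t - z)
    rw [← lintegral_indicator_one hms, lintegral_prod _
      (Measurable.indicator (f := (1 : (ℕ → ℝ) × (ℕ → ℝ) → ℝ≥0∞)) measurable_one hms).aemeasurable]
    rfl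
  rw [survivalProb, measureReal_def, key, ← integral_toReal]
  · rfl
  · have : Measurable fun y : ℝ => (PT.prod PZ) (survivalSet c y) :=
      Monotone.measurable fun _ _ h => measure_mono (survivalSet_mono c h)
    exact (this.comp (by fun_prop : Measurable fun p : ℝ × ℝ => x + c * p.1 - p.2)).aemeasurable
  · exact Eventually.of_forall fun p => measure_lt_top _ _

theorem ae_tendsto_average_infinitePi (hν : Integrable id ν) :
    ∀ᵐ z : ℕ → ℝ ∂(Measure.infinitePi fun _ : ℕ => ν),
      Tendsto (fun n : ℕ => (∑ k ∈ Finset.range n, z k) / n) atTop (𝓝 (∫ y, y ∂ν)) := by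
  have hmap : ∀ i : ℕ, Measure.map (fun z : ℕ → ℝ => z i) (Measure.infinitePi fun _ : ℕ => ν) = ν :=
    fun i => Measure.infinitePi_map_eval (μ := fun _ : ℕ => ν) i
  have hind : iIndepFun (fun (i : ℕ) (z : ℕ → ℝ) => z i) (Measure.infinitePi fun _ : ℕ => ν) :=
    iIndepFun_infinitePi (P := fun _ : ℕ => ν) (X := fun _ x => x) (fun _ => measurable_id)
  have hmp : MeasurePreserving (fun z : ℕ → ℝ => z 0) (Measure.infinitePi fun _ : ℕ => ν) ν :=
    ⟨by fun_prop, hmap 0⟩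
  have := strong_law_ae_real (fun (i : ℕ) (z : ℕ → ℝ) => z i)
    (μ := Measure.infinitePi fun _ : ℕ => ν) (hmp.integrable_comp_of_integrable hν)
    (fun i j hij => hind.indepFun hij)
    (fun i => ⟨Measurable.aemeasurable (by fun_prop), Measurable.aemeasurable (by fun_prop),
      by rw [hmap, hmap]⟩)
  rwa [show ∫ z : ℕ → ℝ, z 0 ∂(Measure.infinitePi fun _ : ℕ => ν) = ∫ y, y ∂ν by
    rw [← hmp.map_eq, integral_map (Measurable.aemeasurable (by fun_prop)) (by fun_prop), hmp.map_eq]] at this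

/-- By the strong law the walk is almost surely eventually at most 0, so its supremum is finite and
the increasing sets `survivalSet c x` exhaust the space up to a null set. -/
theorem tendsto_survivalProb_atTop (hτ : Integrable id τ) (hν : Integrable id ν)
    (h : ∫ y, y ∂ν < c * ∫ t, t ∂τ) : Tendsto (survivalProb τ ν c) atTop (𝓝 1) := by
  have hae : ∀ᵐ p ∂((Measure.infinitePi fun _ : ℕ => τ).prod (Measure.infinitePi fun _ : ℕ => ν)),
      p ∈ ⋃ x : ℝ, survivalSet c x := by
    filter_upwards [Measure.quasiMeasurePreserving_fst.ae (ae_tendsto_average_infinitePi hτ),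
      Measure.quasiMeasurePreserving_snd.ae (ae_tendsto_average_infinitePi hν)] with p h1 h2
    have h3 := h2.sub (h1.const_mul c)
    have h4 : ∀ᶠ n : ℕ in atTop, ∑ k ∈ Finset.range n, (p.2 k - c * p.1 k) ≤ 0 := by
      filter_upwards [h3.eventually_lt_const (sub_neg.2 h), eventually_gt_atTop 0] with n hn hn0
      have hn0' : (0 : ℝ) < n := Nat.cast_pos.2 hn0
      rw [← mul_div_assoc, ← sub_div, div_lt_iff₀ hn0', zero_mul] at hn
      rw [Finset.sum_sub_distrib, ← Finset.mul_sum]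
      exact hn.le
    obtain ⟨M, hM⟩ := eventually_atTop.1 h4
    rw [Set.mem_iUnion]
    -- This capital dominates each of the first M partial sums; from M on the partial sums are at
    -- most 0.
    refine ⟨∑ n ∈ Finset.range M, |∑ k ∈ Finset.range n, (p.2 k - c * p.1 k)|, fun n => ?_⟩
    by_cases hn : n < M
    · exact (le_abs_self _).trans (Finset.single_le_sum
        (f := fun n => |∑ k ∈ Finset.range n, (p.2 k - c * p.1 k)|)
        (fun _ _ => abs_nonneg _) (Finset.mem_range.2 hn))
    · exact (hM n (not_lt.1 hn)).trans (Finset.sum_nonneg fun _ _ => abs_nonneg _)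
  have h1 : ((Measure.infinitePi fun _ : ℕ => τ).prod (Measure.infinitePi fun _ : ℕ => ν))
      (⋃ x : ℝ, survivalSet c x) = 1 := by
    exact (measure_congr (eventuallyEq_univ.2 hae)).trans measure_univ
  have h2 := tendsto_measure_iUnion_atTop
    (μ := (Measure.infinitePi fun _ : ℕ => τ).prod (Measure.infinitePi fun _ : ℕ => ν))
    (survivalSet_mono c)
  rw [h1] at h2
  exact (ENNReal.tendsto_toReal ENNReal.one_ne_top).comp h2

end

/-! ### Exponential interarrival times -/

theorem expMeasure_eq_withDensity (α : ℝ) :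
    expMeasure α = (volume.restrict (Set.Ioi 0)).withDensity
      (fun t => ENNReal.ofReal (α * Real.exp (-(α * t)))) := by
  rw [← withDensity_indicator measurableSet_Ioi, expMeasure, gammaMeasure]
  refine withDensity_congr_ae ?_
  filter_upwards [Measure.ae_ne volume (0 : ℝ)] with t ht
  change exponentialPDF α t = _
  rw [exponentialPDF_eq]
  rcases lt_or_gt_of_ne ht with h | h
  · rw [if_neg (not_le.2 h), Set.indicator_of_notMem (by simpa using h.le), ENNReal.ofReal_zero]
  · rw [if_pos h.le, Set.indicator_of_mem (by simpa using h)]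

theorem integral_expMeasure {E : Type*} [NormedAddCommGroup E] [NormedSpace ℝ E] {α : ℝ}
    (hα : 0 < α) (f : ℝ → E) :
    ∫ t, f t ∂(expMeasure α) = ∫ t in Set.Ioi 0, (α * Real.exp (-(α * t))) • f t := by
  rw [expMeasure_eq_withDensity, integral_withDensity_eq_integral_toReal_smul (by fun_prop)
    (Eventually.of_forall fun _ => ENNReal.ofReal_lt_top)]
  congr 1
  ext t
  rw [ENNReal.toReal_ofReal (by positivity)]

theorem integrable_expMeasure_iff {E : Type*} [NormedAddCommGroup E] [NormedSpace ℝ E] {α : ℝ}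
    (hα : 0 < α) {f : ℝ → E} : Integrable f (expMeasure α) ↔
      IntegrableOn (fun t => (α * Real.exp (-(α * t))) • f t) (Set.Ioi 0) := by
  rw [expMeasure_eq_withDensity, integrable_withDensity_iff_integrable_smul' (by fun_prop)
    (Eventually.of_forall fun _ => ENNReal.ofReal_lt_top), IntegrableOn]
  refine integrable_congr (Eventually.of_forall fun t => ?_)
  simp only
  rw [ENNReal.toReal_ofReal (by positivity)]

theorem ae_pos_expMeasure (α : ℝ) : ∀ᵐ t ∂(expMeasure α), 0 < t := by
  rw [expMeasure_eq_withDensity]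
  exact (withDensity_absolutelyContinuous _ _).ae_le (ae_restrict_mem measurableSet_Ioi)

theorem integrable_id_expMeasure {α : ℝ} (hα : 0 < α) : Integrable id (expMeasure α) := by
  rw [integrable_expMeasure_iff hα]
  have h := integrableOn_rpow_mul_exp_neg_mul_rpow (s := 1) (p := 1) (b := α) (by norm_num) zero_lt_one hα
  refine (h.const_mul α).congr (Eventually.of_forall fun t => ?_)
  simp
  ring

theorem integral_id_expMeasure {α : ℝ} (hα : 0 < α) : ∫ t, t ∂(expMeasure α) = 1 / α := by
  have h := Real.integral_rpow_mul_exp_neg_mul_Ioi (a := 2) (by norm_num) hα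
  rw [integral_expMeasure hα]
  have : ∀ t : ℝ, (α * Real.exp (-(α * t))) • t = α * (t ^ ((2 : ℝ) - 1) * Real.exp (-(α * t))) := fun t => by
    rw [show (2 : ℝ) - 1 = 1 by norm_num, Real.rpow_one, smul_eq_mul]; ring
  simp_rw [this]
  rw [integral_const_mul, h, Real.Gamma_two]
  norm_num
  field_simp

theorem integrable_cexp_expMeasure {α : ℝ} (hα : 0 < α) {w : ℂ} (hw : w.re < α) :
    Integrable (fun t : ℝ => Complex.exp (w * t)) (expMeasure α) := by
  rw [integrable_expMeasure_iff hα]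
  have : IntegrableOn (fun t : ℝ => (α : ℂ) * Complex.exp ((w - α) * t)) (Set.Ioi 0) :=
    (integrableOn_exp_mul_complex_Ioi (by simpa using hw) 0).const_mul _
  refine this.congr (Eventually.of_forall fun t => ?_)
  simp only
  rw [Complex.real_smul, Complex.ofReal_mul, Complex.ofReal_exp, mul_assoc, ← Complex.exp_add]
  push_cast
  ring_nf

theorem integral_cexp_expMeasure {α : ℝ} (hα : 0 < α) {w : ℂ} (hw : w.re < α) :
    ∫ t : ℝ, Complex.exp (w * t) ∂(expMeasure α) = α / (α - w) := by
  rw [integral_expMeasure hα]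
  have : ∀ t : ℝ, (α * Real.exp (-(α * t))) • Complex.exp (w * t) =
      (α : ℂ) * Complex.exp ((w - α) * t) := fun t => by
    rw [Complex.real_smul, Complex.ofReal_mul, Complex.ofReal_exp, mul_assoc, ← Complex.exp_add]
    push_cast
    ring_nf
  simp_rw [this]
  rw [integral_const_mul, integral_exp_mul_complex_Ioi (by simpa using hw) 0]
  have : (α : ℂ) - w ≠ 0 := fun h => by
    rw [← sub_eq_zero.1 h] at hw; simp at hw
  have h' : w - α ≠ 0 := by rw [← neg_sub]; exact neg_ne_zero.2 this
  simp
  field_simp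
  ring

/-! ### Regularity of the renewal average -/

section

variable {ν : Measure ℝ} {α c : ℝ}

/-- The claim-averaged survival probability `u ↦ E[φ(u - Z)]` before the claim is paid. -/
noncomputable def claimAverage (α : ℝ) (ν : Measure ℝ) (c u : ℝ) : ℝ :=
  ∫ z, survivalProb (expMeasure α) ν c (u - z) ∂ν

/-- The survival probability averaged over the first interarrival time and claim, as a function of
an arbitrary real initial capital. -/
noncomputable def renewalAverage (α : ℝ) (ν : Measure ℝ) (c x : ℝ) : ℝ :=
  ∫ p : ℝ × ℝ, survivalProb (expMeasure α) ν c (x + c * p.1 - p.2) ∂((expMeasure α).prod ν)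

theorem claimAverage_nonneg (u : ℝ) : 0 ≤ claimAverage α ν c u :=
  integral_nonneg fun _ => survivalProb_nonneg _

theorem claimAverage_of_neg (hν : ∀ᵐ z ∂ν, 0 ≤ z) {u : ℝ} (hu : u < 0) :
    claimAverage α ν c u = 0 := by
  refine integral_eq_zero_of_ae ?_
  filter_upwards [hν] with z hz
  exact survivalProb_of_neg (by linarith)

variable [IsProbabilityMeasure ν]

theorem measurable_survivalProb (hα : 0 < α) : Measurable (survivalProb (expMeasure α) ν c) :=
  have := isProbabilityMeasure_expMeasure hα
  monotone_survivalProb.measurable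

theorem abs_survivalProb_le_one (hα : 0 < α) (x : ℝ) : ‖survivalProb (expMeasure α) ν c x‖ ≤ 1 := by
  have := isProbabilityMeasure_expMeasure hα
  rw [Real.norm_of_nonneg (survivalProb_nonneg x)]
  exact survivalProb_le_one x

theorem integrable_survivalProb_comp {X : Type*} [MeasurableSpace X] {μ : Measure X}
    [IsFiniteMeasure μ] (hα : 0 < α) {g : X → ℝ} (hg : Measurable g) :
    Integrable (fun p => survivalProb (expMeasure α) ν c (g p)) μ :=
  Integrable.of_bound ((measurable_survivalProb hα).comp hg).aestronglyMeasurable 1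
    (Eventually.of_forall fun p => abs_survivalProb_le_one hα (g p))

theorem claimAverage_le_one (hα : 0 < α) (u : ℝ) : claimAverage α ν c u ≤ 1 := by
  have := isProbabilityMeasure_expMeasure hα
  have := integral_mono (integrable_survivalProb_comp (μ := ν) (ν := ν) (c := c) hα
    (by fun_prop : Measurable fun z : ℝ => u - z)) (integrable_const 1) fun z => survivalProb_le_one _
  simpa [claimAverage] using this

theorem monotone_claimAverage (hα : 0 < α) : Monotone (claimAverage α ν c) := fun u v h => by
  have := isProbabilityMeasure_expMeasure hα
  exact integral_mono (integrable_survivalProb_comp hα (by fun_prop))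
    (integrable_survivalProb_comp hα (by fun_prop))
    fun z => monotone_survivalProb (by simpa using h)

theorem integrable_exp_mul_claimAverage (hα : 0 < α) (hν : ∀ᵐ z ∂ν, 0 ≤ z) {β : ℝ} (hβ : 0 < β) :
    Integrable fun u => Real.exp (-(β * u)) * claimAverage α ν c u := by
  have h1 : IntegrableOn (fun u => Real.exp (-(β * u))) (Set.Ici (0:ℝ)) := by
    rw [integrableOn_Ici_iff_integrableOn_Ioi]
    simpa using integrableOn_exp_mul_Ioi (neg_lt_zero.2 hβ) 0
  refine ((integrable_indicator_iff measurableSet_Ici).2 h1).mono' ?_ (Eventually.of_forall fun u => ?_)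
  · exact (Measurable.mul (by fun_prop) (monotone_claimAverage hα).measurable).aestronglyMeasurable
  · rcases lt_or_ge u 0 with h | h
    · rw [claimAverage_of_neg hν h, Set.indicator_of_notMem (by simpa using h)]; simp
    · rw [Set.indicator_of_mem (by simpa using h), norm_mul, Real.norm_of_nonneg (Real.exp_pos _).le,
        Real.norm_of_nonneg (claimAverage_nonneg u)]
      exact mul_le_of_le_one_right (Real.exp_pos _).le (claimAverage_le_one hα u)

/-- The substitution u = x + ct moves x into an exponential prefactor and the lower limit of
integration. Continuity in x and the explicit values for x ≤ 0 are read off from this form. -/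
theorem renewalAverage_eq (hα : 0 < α) (hc : 0 < c) (x : ℝ) :
    renewalAverage α ν c x = α / c * Real.exp (α / c * x) *
      ∫ u in Set.Ioi x, Real.exp (-(α / c * u)) * claimAverage α ν c u := by
  have := isProbabilityMeasure_expMeasure hα
  rw [renewalAverage, integral_prod _ (integrable_survivalProb_comp hα (by fun_prop))]
  change ∫ t, claimAverage α ν c (x + c * t) ∂_ = _
  rw [integral_expMeasure hα]
  have h1 := integral_comp_mul_left_Ioi (fun s => (α * Real.exp (-(α / c * s))) *
    claimAverage α ν c (x + s)) 0 hc
  rw [mul_zero] at h1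
  have h2 : ∀ t, (α * Real.exp (-(α * t))) • claimAverage α ν c (x + c * t) =
      (α * Real.exp (-(α / c * (c * t)))) * claimAverage α ν c (x + c * t) := fun t => by
    rw [← mul_assoc (α / c), div_mul_cancel₀ _ hc.ne', smul_eq_mul]
  simp_rw [h2]
  rw [h1, ← integral_indicator measurableSet_Ioi, ← integral_indicator measurableSet_Ioi,
    
    ← integral_add_left_eq_self ((Set.Ioi x).indicator _) x, smul_eq_mul, ← integral_const_mul, ← integral_const_mul]
  congr 1
  ext s
  by_cases hs : s ∈ Set.Ioi (0 : ℝ)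
  · have hs' : x + s ∈ Set.Ioi x := by simpa using hs
    rw [Set.indicator_of_mem hs, Set.indicator_of_mem hs',
      show -(α / c * (x + s)) = -(α / c * x) + -(α / c * s) by ring, Real.exp_add, Real.exp_neg (α / c * x)]
    have := (Real.exp_pos (α / c * x)).ne'
    field_simp
  · have hs' : x + s ∉ Set.Ioi x := by simpa using hs
    rw [Set.indicator_of_notMem hs, Set.indicator_of_notMem hs']; simp

theorem survivalProb_eq_renewalAverage (hα : 0 < α) {x : ℝ} (hx : 0 ≤ x) :
    survivalProb (expMeasure α) ν c x = renewalAverage α ν c x :=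
  have := isProbabilityMeasure_expMeasure hα
  survivalProb_eq_integral hx

/-- Below zero the claim average vanishes, so moving the lower limit from x to 0 changes nothing and
only the prefactor depends on x. -/
theorem renewalAverage_of_nonpos (hα : 0 < α) (hc : 0 < c) (hν : ∀ᵐ z ∂ν, 0 ≤ z) {x : ℝ} (hx : x ≤ 0) :
    renewalAverage α ν c x = survivalProb (expMeasure α) ν c 0 * Real.exp (α / c * x) := by
  rw [survivalProb_eq_renewalAverage hα le_rfl, renewalAverage_eq hα hc, renewalAverage_eq hα hc]
  have hI := integrable_exp_mul_claimAverage (c := c) hα hν (div_pos hα hc)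
  have h1 : ∫ u in Set.Ioi x, Real.exp (-(α / c * u)) * claimAverage α ν c u =
      ∫ u in Set.Ioi 0, Real.exp (-(α / c * u)) * claimAverage α ν c u := by
    rw [← integral_Ici_eq_integral_Ioi (x := (0:ℝ)), ← integral_Ici_eq_integral_Ioi]
    refine setIntegral_eq_of_subset_of_forall_sdiff_eq_zero
      (f := fun u => Real.exp (-(α / c * u)) * claimAverage α ν c u) (μ := volume) measurableSet_Ici
      (Set.Ici_subset_Ici.2 hx) fun u hu => ?_
    rw [claimAverage_of_neg hν (by simpa using hu.2), mul_zero]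
  rw [h1, mul_zero, Real.exp_zero]
  ring

/-- The exponential waiting time smooths out possible atoms of the claim law. The resulting
continuity of the survival probability on [0, ∞) is what Fourier inversion needs. -/
theorem continuous_renewalAverage (hα : 0 < α) (hc : 0 < c) (hν : ∀ᵐ z ∂ν, 0 ≤ z) :
    Continuous (renewalAverage α ν c) := by
  have hI := integrable_exp_mul_claimAverage (c := c) hα hν (div_pos hα hc)
  have h : ∀ x, renewalAverage α ν c x = α / c * Real.exp (α / c * x) *
      ((∫ u in Set.Ioi 0, Real.exp (-(α / c * u)) * claimAverage α ν c u) -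
        ∫ u in (0:ℝ)..x, Real.exp (-(α / c * u)) * claimAverage α ν c u) := fun x => by
    rw [renewalAverage_eq hα hc, ← intervalIntegral.integral_Ioi_sub_Ioi' hI.integrableOn hI.integrableOn,
      sub_sub_cancel]
  rw [funext h]
  exact Continuous.mul (by fun_prop) (continuous_const.sub (hI.continuous_primitive 0))

theorem continuousOn_survivalProb (hα : 0 < α) (hc : 0 < c) (hν : ∀ᵐ z ∂ν, 0 ≤ z) :
    ContinuousOn (survivalProb (expMeasure α) ν c) (Set.Ici 0) :=
  (continuous_renewalAverage hα hc hν).continuousOn.congr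
    fun _ hx => survivalProb_eq_renewalAverage hα hx

end

/-! ### The Laplace transform of the survival probability -/

section

variable {ν : Measure ℝ} {α c : ℝ}

theorem integral_cexp_mul_survivalProb (u : ℂ) :
    ∫ x : ℝ, Complex.exp (u * x) * survivalProb (expMeasure α) ν c x =
      ∫ x : ℝ in Set.Ioi 0, Complex.exp (u * x) * survivalProb (expMeasure α) ν c x := by
  rw [← integral_Ici_eq_integral_Ioi]
  refine (setIntegral_eq_integral_of_forall_compl_eq_zero fun x hx => ?_).symm
  rw [survivalProb_of_neg (by simpa using hx)]; simp

variable [IsProbabilityMeasure ν]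

theorem integrable_cexp_mul_survivalProb (hα : 0 < α) {u : ℂ} (hu : u.re < 0) :
    Integrable fun x : ℝ => Complex.exp (u * x) * survivalProb (expMeasure α) ν c x := by
  have h1 : IntegrableOn (fun x => Real.exp (u.re * x)) (Set.Ici (0:ℝ)) := by
    rw [integrableOn_Ici_iff_integrableOn_Ioi]
    exact integrableOn_exp_mul_Ioi hu 0
  refine ((integrable_indicator_iff measurableSet_Ici).2 h1).mono' ?_ (Eventually.of_forall fun x => ?_)
  · exact (Measurable.mul (by fun_prop)
      (Complex.measurable_ofReal.comp (measurable_survivalProb hα))).aestronglyMeasurable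
  · rcases lt_or_ge x 0 with h | h
    · rw [survivalProb_of_neg h, Set.indicator_of_notMem (by simpa using h)]; simp
    · rw [Set.indicator_of_mem (by simpa using h), norm_mul, Complex.norm_exp, Complex.norm_real]
      have : (u * x).re = u.re * x := by simp
      rw [this]
      exact mul_le_of_le_one_right (Real.exp_pos _).le (abs_survivalProb_le_one hα x)

/-- The transform of the renewal average, by Fubini's theorem. -/
theorem integral_cexp_mul_renewalAverage (hα : 0 < α) (hc : 0 < c) (hν : ∀ᵐ z ∂ν, 0 ≤ z)
    {u : ℂ} (hu : u.re < 0) (hu' : -(α / c) < u.re) :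
    ∫ x : ℝ, Complex.exp (u * x) * renewalAverage α ν c x =
      (α / (α + u * c)) * (∫ z : ℝ, Complex.exp (u * z) ∂ν) *
        ∫ x : ℝ, Complex.exp (u * x) * survivalProb (expMeasure α) ν c x := by
  have := isProbabilityMeasure_expMeasure hα
  set φ := survivalProb (expMeasure α) ν c with hφ
  have hw : (-(u * c)).re < α := by
    rw [← neg_div, div_lt_iff₀ hc] at hu'
    simp
    linarith
  -- Each pair (T, Z) translates φ, and a translation multiplies the transform by e^{-ucT} e^{uZ}.
  -- The bound -(α/c) < Re u is exactly what makes the factor in T integrable.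
  have htrans : ∀ (p : ℝ × ℝ) (x : ℝ), Complex.exp (u * x) * φ (x + c * p.1 - p.2) =
      Complex.exp (-(u * c) * p.1) * Complex.exp (u * p.2) *
        (Complex.exp (u * (x + (c * p.1 - p.2) : ℝ)) * φ (x + (c * p.1 - p.2))) := fun p x => by
    rw [← mul_assoc, ← Complex.exp_add, ← Complex.exp_add, add_sub_assoc]
    push_cast
    ring_nf
  have hi : Integrable fun x : ℝ => Complex.exp (u * x) * φ x := integrable_cexp_mul_survivalProb hα hu
  have hie : Integrable (fun z : ℝ => Complex.exp (u * z)) ν := by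
    refine Integrable.of_bound (by fun_prop) 1 ?_
    filter_upwards [hν] with z hz
    rw [Complex.norm_exp, Real.exp_le_one_iff]
    simpa using mul_nonpos_of_nonpos_of_nonneg hu.le hz
  have hpe : Integrable (fun p : ℝ × ℝ => Complex.exp (-(u * c) * p.1) * Complex.exp (u * p.2))
      ((expMeasure α).prod ν) := (integrable_cexp_expMeasure hα hw).mul_prod hie
  have hprod : Integrable (Function.uncurry fun (x : ℝ) (p : ℝ × ℝ) =>
      Complex.exp (u * x) * φ (x + c * p.1 - p.2)) (volume.prod ((expMeasure α).prod ν)) := by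
    rw [integrable_prod_iff']
    · constructor
      · refine Eventually.of_forall fun p => ?_
        simp only [Function.uncurry_apply_pair, htrans p]
        exact (hi.comp_add_right (c * p.1 - p.2)).const_mul _
      · have : ∀ p : ℝ × ℝ, ∫ x : ℝ, ‖Function.uncurry (fun (x : ℝ) (p : ℝ × ℝ) =>
            Complex.exp (u * x) * φ (x + c * p.1 - p.2)) (x, p)‖ =
            ‖Complex.exp (-(u * c) * p.1) * Complex.exp (u * p.2)‖ *
              ∫ x : ℝ, ‖Complex.exp (u * x) * φ x‖ := fun p => by
          simp only [Function.uncurry_apply_pair, htrans p]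
          simp_rw [norm_mul (Complex.exp (-(u * c) * p.1) * Complex.exp (u * p.2))]
          rw [integral_const_mul, integral_add_right_eq_self
            (fun y : ℝ => ‖Complex.exp (u * y) * φ y‖)]
        simp_rw [this]
        exact hpe.norm.mul_const _
    · refine Measurable.aestronglyMeasurable (Measurable.mul (by fun_prop) ?_)
      exact Complex.measurable_ofReal.comp ((measurable_survivalProb hα).comp (by fun_prop))
  have h1 : ∀ x : ℝ, Complex.exp (u * x) * renewalAverage α ν c x =
      ∫ p : ℝ × ℝ, Complex.exp (u * x) * φ (x + c * p.1 - p.2) ∂((expMeasure α).prod ν) := fun x => by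
    rw [integral_const_mul]
    congr 1
    exact integral_ofReal.symm
  simp_rw [h1]
  rw [integral_integral_swap hprod]
  have h2 : ∀ p : ℝ × ℝ, ∫ x : ℝ, Complex.exp (u * x) * φ (x + c * p.1 - p.2) =
      Complex.exp (-(u * c) * p.1) * Complex.exp (u * p.2) * ∫ x : ℝ, Complex.exp (u * x) * φ x :=
    fun p => by
    simp only [htrans p]
    rw [integral_const_mul, integral_add_right_eq_self (fun y : ℝ => Complex.exp (u * y) * φ y)]
  simp_rw [h2]
  rw [integral_mul_const, integral_prod_mul (fun t : ℝ => Complex.exp (-(u * c) * t))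
    (fun z : ℝ => Complex.exp (u * z)), integral_cexp_expMeasure hα hw, sub_neg_eq_add]

/-- The transform of the survival probability. -/
theorem lundberg_mul_integral_survivalProb (hα : 0 < α) (hc : 0 < c) (hν : ∀ᵐ z ∂ν, 0 ≤ z)
    {u : ℂ} (hu : u.re < 0) (hu' : -(α / c) < u.re) :
    (u - α / c * ((∫ z : ℝ, Complex.exp (u * z) ∂ν) - 1)) *
      ∫ x : ℝ in Set.Ioi 0, Complex.exp (u * x) * survivalProb (expMeasure α) ν c x =
      -survivalProb (expMeasure α) ν c 0 := by
  have h1 := integral_cexp_mul_renewalAverage hα hc hν hu hu'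
  rw [integral_cexp_mul_survivalProb] at h1
  have hpos : 0 < (u + (α / c : ℝ)).re := by simp; linarith
  have hIic : IntegrableOn (fun x : ℝ => Complex.exp (u * x) * renewalAverage α ν c x) (Set.Iic 0) := by
    refine IntegrableOn.congr_fun ((integrableOn_exp_mul_complex_Iic hpos 0).const_mul
      (survivalProb (expMeasure α) ν c 0 : ℂ)) (fun x hx => ?_) measurableSet_Iic
    rw [renewalAverage_of_nonpos hα hc hν hx]
    push_cast
    rw [add_mul, Complex.exp_add]
    ring
  -- The transform of the renewal average runs over the whole line, whereas φ lives on the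
  -- half-line. The difference is this explicit term, and its pole at -α/c clears against the factor
  -- α/(α + uc).
  have hIicval : ∫ x : ℝ in Set.Iic 0, Complex.exp (u * x) * renewalAverage α ν c x =
      survivalProb (expMeasure α) ν c 0 * (1 / (u + (α / c : ℝ))) := by
    have := integral_exp_mul_complex_Iic hpos 0
    simp only [Complex.ofReal_zero, mul_zero, Complex.exp_zero] at this
    rw [← this, ← integral_const_mul]
    refine setIntegral_congr_fun measurableSet_Iic fun x hx => ?_
    rw [renewalAverage_of_nonpos hα hc hν hx]
    push_cast
    rw [add_mul, Complex.exp_add]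
    ring
  have hcongr : ∀ x ∈ Set.Ioi (0:ℝ), Complex.exp (u * x) * survivalProb (expMeasure α) ν c x =
      Complex.exp (u * x) * renewalAverage α ν c x := fun x hx => by
    rw [survivalProb_eq_renewalAverage hα (le_of_lt hx)]
  have hIoi : IntegrableOn (fun x : ℝ => Complex.exp (u * x) * renewalAverage α ν c x) (Set.Ioi 0) :=
    (integrable_cexp_mul_survivalProb hα hu).integrableOn.congr_fun hcongr measurableSet_Ioi
  rw [← intervalIntegral.integral_Iic_add_Ioi hIic hIoi, hIicval,
    ← setIntegral_congr_fun measurableSet_Ioi hcongr] at h1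
  set Φ := ∫ x : ℝ in Set.Ioi 0, Complex.exp (u * x) * survivalProb (expMeasure α) ν c x
  set M := ∫ z : ℝ, Complex.exp (u * z) ∂ν
  have hc' : (c : ℂ) ≠ 0 := Complex.ofReal_ne_zero.2 hc.ne'
  have hne : u + (α / c : ℝ) ≠ 0 := fun h => by rw [h] at hpos; simp at hpos
  push_cast at hne h1
  have hne' : (α : ℂ) + u * c ≠ 0 := fun h => hne (by field_simp; linear_combination h)
  have hne'' : u * c + (α : ℂ) ≠ 0 := by rwa [add_comm]
  field_simp at h1 ⊢
  refine mul_right_cancel₀ hne'' ?_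
  linear_combination h1

end

/-! ### The Lundberg function and the transform of the ruin probability -/

/-- The function `u - β (E[e^{u ζ}] - 1)`, whose zeros are the exponents of the ruin probability. -/
noncomputable def lundbergFun {Ω : Type*} [MeasurableSpace Ω] (P : Measure Ω) (β : ℝ) (ζ : Ω → ℝ)
    (u : ℂ) : ℂ :=
  u - β * (complexMGF ζ P u - 1)

/-- The derivative of `lundbergFun`. -/
noncomputable def lundbergDeriv {Ω : Type*} [MeasurableSpace Ω] (P : Measure Ω) (β : ℝ) (ζ : Ω → ℝ)
    (u : ℂ) : ℂ :=
  1 - β * ∫ ω, (ζ ω : ℂ) * Complex.exp (u * ζ ω) ∂P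

section

variable {Ω : Type*} [MeasurableSpace Ω] {P : Measure Ω} {β : ℝ} {ζ : Ω → ℝ}

theorem hasDerivAt_lundbergFun {u : ℂ} (hu : u.re ∈ interior (integrableExpSet ζ P)) :
    HasDerivAt (lundbergFun P β ζ) (lundbergDeriv P β ζ u) u :=
  (hasDerivAt_id u).sub (((hasDerivAt_complexMGF hu).sub_const 1).const_mul (β : ℂ))

theorem lundbergFun_zero [IsProbabilityMeasure P] : lundbergFun P β ζ 0 = 0 := by
  simp [lundbergFun, complexMGF]

theorem lundbergDeriv_zero : lundbergDeriv P β ζ 0 = ((1 - β * ∫ ω, ζ ω ∂P : ℝ) : ℂ) := by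
  simp only [lundbergDeriv, zero_mul, Complex.exp_zero, mul_one]
  rw [integral_complex_ofReal]
  push_cast
  rfl

end

section

variable {Ω : Type*} [MeasurableSpace Ω] {P : Measure Ω} [IsProbabilityMeasure P] {α c : ℝ}
  {ζ : Ω → ℝ}

theorem lundbergFun_mul_integral_survivalProb (hα : 0 < α) (hc : 0 < c) (hm : Measurable ζ)
    (hζ : ∀ᵐ ω ∂P, 0 ≤ ζ ω) {u : ℂ} (hu : u.re < 0) (hu' : -(α / c) < u.re) :
    lundbergFun P (α / c) ζ u * ∫ x : ℝ in Set.Ioi 0,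
      Complex.exp (u * x) * survivalProb (expMeasure α) (P.map ζ) c x =
      -survivalProb (expMeasure α) (P.map ζ) c 0 := by
  have := Measure.isProbabilityMeasure_map (μ := P) hm.aemeasurable
  have h := lundberg_mul_integral_survivalProb (ν := P.map ζ) hα hc
    ((ae_map_iff hm.aemeasurable measurableSet_Ici).2 hζ) hu hu'
  rw [integral_map hm.aemeasurable (by fun_prop)] at h
  rw [← h, lundbergFun, complexMGF]
  push_cast
  rfl

/-- An Abelian theorem: after the substitution y = sx the integrand is e^{-y} φ(y/s), which
converges to e^{-y} by dominated convergence. The positive drift enters through φ → 1 at infinity.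
-/
theorem tendsto_mul_integral_survivalProb (hα : 0 < α) (hm : Measurable ζ)
    (hi : Integrable ζ P) (hdrift : 0 < c - α * ∫ ω, ζ ω ∂P) :
    Tendsto (fun s : ℝ => (s : ℂ) * ∫ x : ℝ in Set.Ioi 0,
      Complex.exp ((-s : ℝ) * x) * survivalProb (expMeasure α) (P.map ζ) c x) (𝓝[>] 0) (𝓝 1) := by
  have := Measure.isProbabilityMeasure_map (μ := P) hm.aemeasurable
  have := isProbabilityMeasure_expMeasure hα
  set φ := survivalProb (expMeasure α) (P.map ζ) c with hφ
  have hlim : Tendsto φ atTop (𝓝 1) := by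
    refine tendsto_survivalProb_atTop (integrable_id_expMeasure hα) ?_ ?_
    · rw [integrable_map_measure (by fun_prop) hm.aemeasurable]; exact hi
    · rw [integral_map hm.aemeasurable (by fun_prop), integral_id_expMeasure hα, mul_one_div,
        lt_div_iff₀ hα]
      linarith
  have h1 : Tendsto (fun s : ℝ => ∫ y : ℝ in Set.Ioi 0, Real.exp (-y) * φ (s⁻¹ * y)) (𝓝[>] 0)
      (𝓝 (∫ y : ℝ in Set.Ioi 0, Real.exp (-y) * 1)) := by
    refine tendsto_integral_filter_of_dominated_convergence (fun y => Real.exp (-y)) ?_ ?_ ?_ ?_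
    · exact Eventually.of_forall fun s => (Measurable.mul (by fun_prop)
        ((measurable_survivalProb hα).comp (by fun_prop))).aestronglyMeasurable
    · refine Eventually.of_forall fun s => Eventually.of_forall fun y => ?_
      rw [norm_mul, Real.norm_of_nonneg (Real.exp_pos _).le]
      exact mul_le_of_le_one_right (Real.exp_pos _).le (abs_survivalProb_le_one hα _)
    · simpa [IntegrableOn] using integrableOn_exp_mul_Ioi (a := -1) (by norm_num) 0
    · filter_upwards [ae_restrict_mem measurableSet_Ioi] with y hy
      exact (hlim.comp (tendsto_inv_nhdsGT_zero.atTop_mul_const hy)).const_mul _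
  have h2 : ∫ y : ℝ in Set.Ioi 0, Real.exp (-y) * 1 = 1 := by
    simpa using integral_exp_neg_Ioi 0
  rw [h2] at h1
  have h3 := (Complex.continuous_ofReal.tendsto 1).comp h1
  rw [Complex.ofReal_one] at h3
  refine h3.congr' ?_
  filter_upwards [self_mem_nhdsWithin] with s hs
  have hs' : (0 : ℝ) < s := hs
  have h4 := integral_comp_mul_left_Ioi (fun y => Real.exp (-y) * φ (s⁻¹ * y)) 0 hs'
  rw [mul_zero, smul_eq_mul, eq_inv_mul_iff_mul_eq₀ hs'.ne'] at h4
  rw [Function.comp_apply, ← h4, Complex.ofReal_mul, ← integral_complex_ofReal]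
  congr 2
  ext x
  rw [inv_mul_cancel_left₀ hs'.ne']
  push_cast
  ring_nf

/-- The survival probability without initial capital. -/
theorem survivalProb_zero (hα : 0 < α) (hc : 0 < c) (hm : Measurable ζ)
    (hζ : ∀ᵐ ω ∂P, 0 ≤ ζ ω) (hi : Integrable ζ P) (h0 : 0 ∈ interior (integrableExpSet ζ P))
    (hdrift : 0 < c - α * ∫ ω, ζ ω ∂P) :
    survivalProb (expMeasure α) (P.map ζ) c 0 = 1 - α / c * ∫ ω, ζ ω ∂P := by
  have hd : HasDerivAt (fun s : ℝ => lundbergFun P (α / c) ζ ((-s : ℝ) : ℂ))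
      (-lundbergDeriv P (α / c) ζ 0) 0 := by
    have h1 : HasDerivAt (fun s : ℝ => ((-s : ℝ) : ℂ)) (-1) 0 := by
      simpa using (hasDerivAt_neg (0 : ℝ)).ofReal_comp
    have h2 : HasDerivAt (lundbergFun P (α / c) ζ) (lundbergDeriv P (α / c) ζ 0) ((-(0 : ℝ) : ℝ) : ℂ) := by
      simpa using hasDerivAt_lundbergFun (β := α / c) (u := 0) (by simpa using h0)
    have h3 := HasDerivAt.scomp (h := fun s : ℝ => ((-s : ℝ) : ℂ)) (0 : ℝ) h2 h1
    rwa [neg_one_smul] at h3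
  have hs := hd.tendsto_slope_zero.mono_left (nhdsGT_le_nhdsNE 0)
  have := hs.mul (tendsto_mul_integral_survivalProb hα hm hi hdrift)
  have hconst : Tendsto (fun _ : ℝ => -(survivalProb (expMeasure α) (P.map ζ) c 0 : ℂ)) (𝓝[>] 0)
      (𝓝 (-lundbergDeriv P (α / c) ζ 0 * 1)) := by
    -- The product of the slope of D at 0 and of s times the transform is the constant -φ(0), so the
    -- two limits determine φ(0).
    refine this.congr' ?_
    filter_upwards [self_mem_nhdsWithin, Ioo_mem_nhdsGT (div_pos hα hc)] with s hs hs2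
    have hs' : (0 : ℝ) < s := hs
    have hsne : (s : ℂ) ≠ 0 := Complex.ofReal_ne_zero.2 hs'.ne'
    have key := lundbergFun_mul_integral_survivalProb hα hc hm hζ (u := ((-s : ℝ) : ℂ))
      (by simpa using hs') (by simpa using hs2.2)
    rw [← key]
    simp only [neg_zero, Complex.ofReal_zero, lundbergFun_zero, sub_zero, zero_add, Complex.real_smul,
      Complex.ofReal_inv]
    rw [mul_mul_mul_comm, inv_mul_cancel₀ hsne, one_mul]
  have h := tendsto_nhds_unique tendsto_const_nhds hconst
  rw [mul_one, lundbergDeriv_zero, neg_inj] at h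
  exact_mod_cast h

/-- The transform of the ruin probability. -/
theorem integral_cexp_mul_one_sub_survivalProb (hα : 0 < α) (hc : 0 < c) (hm : Measurable ζ)
    (hζ : ∀ᵐ ω ∂P, 0 ≤ ζ ω) {u : ℂ} (hu : u.re < 0) (hu' : -(α / c) < u.re)
    (hne : lundbergFun P (α / c) ζ u ≠ 0) :
    ∫ x : ℝ in Set.Ioi 0, Complex.exp (u * x) *
        ((1 - survivalProb (expMeasure α) (P.map ζ) c x : ℝ) : ℂ) =
      -u⁻¹ + survivalProb (expMeasure α) (P.map ζ) c 0 * (lundbergFun P (α / c) ζ u)⁻¹ := by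
  have := Measure.isProbabilityMeasure_map (μ := P) hm.aemeasurable
  have key := lundbergFun_mul_integral_survivalProb hα hc hm hζ hu hu'
  have h1 := integral_exp_mul_complex_Ioi hu 0
  simp only [Complex.ofReal_zero, mul_zero, Complex.exp_zero] at h1
  have h2 : ∀ x : ℝ, Complex.exp (u * x) *
        ((1 - survivalProb (expMeasure α) (P.map ζ) c x : ℝ) : ℂ) = Complex.exp (u * x) -
          Complex.exp (u * x) * survivalProb (expMeasure α) (P.map ζ) c x := fun x => by
    push_cast; ring
  simp_rw [h2]
  rw [integral_sub (integrableOn_exp_mul_complex_Ioi hu 0)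
    (integrable_cexp_mul_survivalProb hα hu).integrableOn, h1, neg_div, one_div, sub_eq_add_neg]
  congr 1
  rw [eq_mul_inv_iff_mul_eq₀ hne]
  linear_combination -key

end

/-! ### The Lundberg equation and the integrated tail -/

section

variable {Ω : Type*} [MeasurableSpace Ω] {P : Measure Ω} {α c R : ℝ}
  {ζ : Ω → ℝ}

theorem mem_interior_integrableExpSet (hR : ∀ s < R, Integrable (fun ω => Real.exp (s * ζ ω)) P)
    {s : ℝ} (hs : s < R) : s ∈ interior (integrableExpSet ζ P) :=
  mem_interior.2 ⟨Set.Iio R, fun t ht => hR t ht, isOpen_Iio, hs⟩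

theorem integral_Ioi_indicator_Iio (u : ℂ) {z : ℝ} (hz : 0 ≤ z) :
    ∫ y in Set.Ioi (0 : ℝ), (Set.Iio z).indicator (fun y : ℝ => Complex.exp (u * y)) y =
      ∫ y in (0 : ℝ)..z, Complex.exp (u * y) := by
  rw [setIntegral_indicator measurableSet_Iio, Set.Ioi_inter_Iio, intervalIntegral.integral_of_le hz,
    integral_Ioc_eq_integral_Ioo]

theorem integral_indicator_cexp (hm : Measurable ζ) (u : ℂ) (y : ℝ) :
    ∫ ω, (Set.Iio (ζ ω)).indicator (fun y : ℝ => Complex.exp (u * y)) y ∂P =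
      Complex.exp (u * y) * P.real {ω | y < ζ ω} := by
  have h : ∀ ω, (Set.Iio (ζ ω)).indicator (fun y : ℝ => Complex.exp (u * y)) y =
      {ω | y < ζ ω}.indicator (fun _ => Complex.exp (u * y)) ω := fun ω => rfl
  simp_rw [h]
  rw [integral_indicator_const _ (measurableSet_lt measurable_const hm), Complex.real_smul, mul_comm]

/-- The transform on the real axis. -/
noncomputable def realLundbergTransform {Ω : Type*} [MeasurableSpace Ω] (P : Measure Ω) (α c : ℝ)
    (ζ : Ω → ℝ) (s : ℝ) : ℝ :=
  ∫ y in Set.Ioi (0 : ℝ), Real.exp (s * y) * (α / c * P.real {ω | y < ζ ω})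

theorem lundbergTransform_ofReal (s : ℝ) :
    lundbergTransform P α c ζ s = realLundbergTransform P α c ζ s := by
  rw [lundbergTransform, realLundbergTransform, ← integral_complex_ofReal]
  congr 1
  ext y
  push_cast
  rfl

theorem norm_lundbergTransform_le (hβ : 0 ≤ α / c) (u : ℂ) :
    ‖lundbergTransform P α c ζ u‖ ≤ realLundbergTransform P α c ζ u.re := by
  refine (norm_integral_le_integral_norm _).trans_eq ?_
  rw [realLundbergTransform]
  congr 1
  ext y
  rw [norm_mul, Complex.norm_exp, Complex.norm_real, Real.norm_of_nonneg
    (mul_nonneg hβ measureReal_nonneg)]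
  simp

theorem integrable_indicator_cexp (hR0 : 0 < R) (hm : Measurable ζ) (hζ : ∀ᵐ ω ∂P, 0 ≤ ζ ω)
    (hR : ∀ s < R, Integrable (fun ω => Real.exp (s * ζ ω)) P) {u : ℂ} (hu : u.re < R) :
    Integrable (Function.uncurry fun (ω : Ω) (y : ℝ) =>
      (Set.Iio (ζ ω)).indicator (fun y : ℝ => Complex.exp (u * y)) y)
      (P.prod (volume.restrict (Set.Ioi 0))) := by
  have hmeas : Measurable (Function.uncurry fun (ω : Ω) (y : ℝ) =>
      (Set.Iio (ζ ω)).indicator (fun y : ℝ => Complex.exp (u * y)) y) := by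
    have : (Function.uncurry fun (ω : Ω) (y : ℝ) =>
      (Set.Iio (ζ ω)).indicator (fun y : ℝ => Complex.exp (u * y)) y) =
        {p : Ω × ℝ | p.2 < ζ p.1}.indicator (fun p => Complex.exp (u * p.2)) := rfl
    rw [this]
    exact Measurable.indicator (by fun_prop) (measurableSet_lt (by fun_prop) (by fun_prop))
  -- With σ > 0 the integral over (0, ζ) may be enlarged to (-∞, ζ], where it equals e^{σζ}/σ; with
  -- σ < R this has finite mean.
  obtain ⟨σ, hσ, hσR⟩ : ∃ σ, max u.re 0 < σ ∧ σ < R := exists_between (max_lt hu hR0)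
  have hσ0 : 0 < σ := (le_max_right _ _).trans_lt hσ
  have hbound : ∀ z : ℝ, IntegrableOn ((Set.Iio z).indicator fun y : ℝ => Complex.exp (u * y))
      (Set.Ioi 0) := fun z => by
    rw [IntegrableOn, integrable_indicator_iff measurableSet_Iio, IntegrableOn,
      Measure.restrict_restrict measurableSet_Iio, Set.Iio_inter_Ioi]
    exact (Continuous.integrableOn_Icc (by fun_prop)).mono_set Set.Ioo_subset_Icc_self
  rw [integrable_prod_iff hmeas.aestronglyMeasurable]
  refine ⟨Eventually.of_forall fun ω => hbound (ζ ω), ?_⟩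
  refine Integrable.mono' (g := fun ω => Real.exp (σ * ζ ω) / σ) ((hR σ hσR).div_const σ)
    hmeas.aestronglyMeasurable.norm.integral_prod_right' ?_
  filter_upwards [hζ] with ω hω
  rw [Real.norm_of_nonneg (integral_nonneg fun _ => norm_nonneg _)]
  have h1 : IntegrableOn (fun y => Real.exp (σ * y)) (Set.Iic (ζ ω)) := integrableOn_exp_mul_Iic hσ0 _
  rw [← integral_exp_mul_Iic hσ0, ← integral_indicator measurableSet_Iic]
  refine (integral_mono_ae (hbound (ζ ω)).norm
    (g := (Set.Iic (ζ ω)).indicator (fun y => Real.exp (σ * y)))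
    ((integrable_indicator_iff measurableSet_Iic).2 h1).integrableOn ?_).trans ?_
  · filter_upwards [ae_restrict_mem measurableSet_Ioi] with y hy
    by_cases h : y < ζ ω
    · rw [Set.indicator_of_mem (by simpa using h),
        Set.indicator_of_mem (by simpa using h.le), Complex.norm_exp]
      refine Real.exp_le_exp.2 ?_
      have : (u * y).re = u.re * y := by simp
      rw [this]
      exact mul_le_mul_of_nonneg_right ((le_max_left _ _).trans hσ.le) (le_of_lt hy)
    · rw [Set.indicator_of_notMem (by simpa using h), norm_zero]
      exact Set.indicator_nonneg (fun _ _ => (Real.exp_pos _).le) _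
  · exact setIntegral_le_integral ((integrable_indicator_iff measurableSet_Iic).2 h1)
      (Eventually.of_forall fun _ => Set.indicator_nonneg (fun _ _ => (Real.exp_pos _).le) _)

variable [IsProbabilityMeasure P]

theorem integrableOn_cexp_mul_tail (hR0 : 0 < R) (hm : Measurable ζ) (hζ : ∀ᵐ ω ∂P, 0 ≤ ζ ω)
    (hR : ∀ s < R, Integrable (fun ω => Real.exp (s * ζ ω)) P) {u : ℂ} (hu : u.re < R) :
    IntegrableOn (fun y : ℝ => Complex.exp (u * y) * P.real {ω | y < ζ ω}) (Set.Ioi 0) := by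
  have := (integrable_indicator_cexp hR0 hm hζ hR hu).integral_prod_right
  exact this.congr (Eventually.of_forall fun y => integral_indicator_cexp hm u y)

/-- Fubini, applied to P(ζ > y) as the expectation of an indicator: the inner integral of e^{uy}
over 0 < y < ζ is (e^{uζ} - 1)/u. It links the roots of the Lundberg equation to the zeros of
`lundbergFun`. -/
theorem lundbergTransform_mul (hR0 : 0 < R) (hm : Measurable ζ) (hζ : ∀ᵐ ω ∂P, 0 ≤ ζ ω)
    (hR : ∀ s < R, Integrable (fun ω => Real.exp (s * ζ ω)) P) {u : ℂ} (hu : u.re < R) :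
    lundbergTransform P α c ζ u * u = (α / c : ℝ) * (complexMGF ζ P u - 1) := by
  rcases eq_or_ne u 0 with rfl | hu0
  · simp [complexMGF]
  have h1 : lundbergTransform P α c ζ u = (α / c : ℝ) *
      ∫ y in Set.Ioi (0 : ℝ), ∫ ω, (Set.Iio (ζ ω)).indicator (fun y : ℝ => Complex.exp (u * y)) y ∂P := by
    rw [lundbergTransform, ← integral_const_mul]
    congr 1
    ext y
    rw [integral_indicator_cexp hm]
    push_cast
    ring
  have h2 : ∫ ω, (∫ y in Set.Ioi (0 : ℝ),
      (Set.Iio (ζ ω)).indicator (fun y : ℝ => Complex.exp (u * y)) y) ∂P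
      = ∫ ω, (Complex.exp (u * ζ ω) - 1) / u ∂P := by
    refine integral_congr_ae ?_
    filter_upwards [hζ] with ω hω
    rw [integral_Ioi_indicator_Iio u hω, integral_exp_mul_complex hu0]
    simp
  have hi : Integrable (fun ω => Complex.exp (u * ζ ω)) P :=
    (integrable_norm_iff (by fun_prop)).1 ((hR _ hu).congr (Eventually.of_forall fun ω => by
      simp [Complex.norm_exp]))
  rw [h1, ← integral_integral_swap (integrable_indicator_cexp hR0 hm hζ hR hu), h2, integral_div,
    integral_sub hi (integrable_const 1), mul_assoc, div_mul_cancel₀ _ hu0]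
  simp [complexMGF]

theorem lundbergFun_eq (hR0 : 0 < R) (hm : Measurable ζ) (hζ : ∀ᵐ ω ∂P, 0 ≤ ζ ω)
    (hR : ∀ s < R, Integrable (fun ω => Real.exp (s * ζ ω)) P) {u : ℂ} (hu : u.re < R) :
    lundbergFun P (α / c) ζ u = u * (1 - lundbergTransform P α c ζ u) := by
  have := lundbergTransform_mul (α := α) (c := c) hR0 hm hζ hR hu
  rw [lundbergFun]
  linear_combination this

/-- Equality would force the tail P(ζ > y) to vanish for almost every y > 0, and then the transform
at t would be 0; hence the hypothesis `h0`. -/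
theorem realLundbergTransform_lt (hR0 : 0 < R) (hm : Measurable ζ) (hζ : ∀ᵐ ω ∂P, 0 ≤ ζ ω)
    (hR : ∀ s < R, Integrable (fun ω => Real.exp (s * ζ ω)) P) (hβ : 0 < α / c) {s t : ℝ} (hst : s < t)
    (ht : t < R) (h0 : realLundbergTransform P α c ζ t ≠ 0) :
    realLundbergTransform P α c ζ s < realLundbergTransform P α c ζ t := by
  have hint : ∀ s : ℝ, s < R →
      IntegrableOn (fun y : ℝ => Real.exp (s * y) * (α / c * P.real {ω | y < ζ ω})) (Set.Ioi 0) :=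
    fun s hs => by
    refine ((integrableOn_cexp_mul_tail hR0 hm hζ hR (u := s) (by simpa using hs)).norm.const_mul
      (α / c)).congr (Eventually.of_forall fun y => ?_)
    simp only [norm_mul, Complex.norm_exp, Complex.norm_real, Real.norm_of_nonneg measureReal_nonneg]
    simp
    ring
  have hnn : ∀ y ∈ Set.Ioi (0:ℝ), Real.exp (s * y) * (α / c * P.real {ω | y < ζ ω}) ≤
      Real.exp (t * y) * (α / c * P.real {ω | y < ζ ω}) := fun y hy =>
    mul_le_mul_of_nonneg_right (Real.exp_le_exp.2 (mul_le_mul_of_nonneg_right hst.le (le_of_lt hy)))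
      (mul_nonneg hβ.le measureReal_nonneg)
  refine lt_of_le_of_ne (setIntegral_mono_on (hint s (hst.trans ht)) (hint t ht) measurableSet_Ioi hnn)
    fun heq => h0 ?_
  have h1 : ∫ y in Set.Ioi (0:ℝ), (Real.exp (t * y) * (α / c * P.real {ω | y < ζ ω}) -
      Real.exp (s * y) * (α / c * P.real {ω | y < ζ ω})) = 0 := by
    rw [integral_sub (hint t ht) (hint s (hst.trans ht))]
    exact sub_eq_zero.2 heq.symm
  rw [setIntegral_eq_zero_iff_of_nonneg_ae
    ((ae_restrict_iff' measurableSet_Ioi).2 (Eventually.of_forall fun y hy => sub_nonneg.2 (hnn y hy)))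
    ((hint t ht).sub (hint s (hst.trans ht)))] at h1
  refine integral_eq_zero_of_ae ?_
  filter_upwards [h1, ae_restrict_mem measurableSet_Ioi] with y hy hy0
  have hlt : Real.exp (s * y) < Real.exp (t * y) :=
    Real.exp_lt_exp.2 (mul_lt_mul_of_pos_right hst hy0)
  rw [← sub_mul] at hy
  have := (mul_eq_zero.1 hy).resolve_left (sub_pos.2 hlt).ne'
  simp [this]

end

/-! ### Location and simplicity of the zeros -/

/-- The trapezoidal rule overestimates the integral of the convex function exp over [0, t]. In the
proof the difference has derivative 1 + x e^x - e^x, nonnegative because 1 - x ≤ e^{-x}. This is the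
source of the bound 1 on the leading coefficient. -/
theorem two_mul_exp_sub_one_le {t : ℝ} (ht : 0 ≤ t) : 2 * (Real.exp t - 1) ≤ t * (Real.exp t + 1) := by
  have hd : ∀ x, HasDerivAt (fun t : ℝ => t * (Real.exp t + 1) - 2 * (Real.exp t - 1))
      (1 * (Real.exp x + 1) + x * Real.exp x - 2 * Real.exp x) x := fun x =>
    ((hasDerivAt_id x).mul ((Real.hasDerivAt_exp x).add_const 1)).sub
      (((Real.hasDerivAt_exp x).sub_const 1).const_mul 2)
  have hmono : Monotone (fun t : ℝ => t * (Real.exp t + 1) - 2 * (Real.exp t - 1)) := by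
    refine monotone_of_deriv_nonneg (fun x => (hd x).differentiableAt) fun x => ?_
    rw [(hd x).deriv]
    have h1 := Real.add_one_le_exp (-x)
    have h2 : Real.exp (-x) * Real.exp x = 1 := by rw [← Real.exp_add]; simp
    nlinarith [Real.exp_pos x]
  have := hmono ht
  simp at this
  linarith

section

variable {Ω : Type*} [MeasurableSpace Ω] {P : Measure Ω} {α c κ r : ℝ} {ζ : Ω → ℝ} {z₁ : ℂ}

/-- Dividing numerator and denominator by c exhibits the coefficient as -φ(0)/D'(w), the negative of
the residue of φ(0)/D at a simple zero w. -/
theorem ruinResidue_eq (hc : 0 < c) (w : ℂ) :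
    ruinResidue P α c ζ w = -((1 - α / c * ∫ ω, ζ ω ∂P : ℝ) : ℂ) * (lundbergDeriv P (α / c) ζ w)⁻¹ := by
  have hc' : (c : ℂ) ≠ 0 := Complex.ofReal_ne_zero.2 hc.ne'
  rw [ruinResidue, lundbergDeriv]
  set E := ∫ ω, (ζ ω : ℂ) * Complex.exp (w * ζ ω) ∂P
  have h1 : (α : ℂ) * E - c = -c * (1 - (α / c : ℝ) * E) := by push_cast; field_simp; ring
  have h2 : ((c - α * ∫ ω, ζ ω ∂P : ℝ) : ℂ) = c * ((1 - α / c * ∫ ω, ζ ω ∂P : ℝ) : ℂ) := by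
    push_cast; field_simp
  rw [h1, h2, div_eq_mul_inv, mul_inv, inv_neg]
  field_simp

theorem lundbergDeriv_conj {β : ℝ} (w : ℂ) :
    lundbergDeriv P β ζ (conj w) = conj (lundbergDeriv P β ζ w) := by
  simp only [lundbergDeriv, map_sub, map_one, map_mul, Complex.conj_ofReal, ← integral_conj,
    ← Complex.exp_conj]

theorem lundbergFun_conj {β : ℝ} (w : ℂ) :
    lundbergFun P β ζ (conj w) = conj (lundbergFun P β ζ w) := by
  simp only [lundbergFun, complexMGF, map_sub, map_one, map_mul, Complex.conj_ofReal, ← integral_conj,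
    ← Complex.exp_conj]

theorem tendsto_sub_mul_inv_lundbergFun {β : ℝ} {p : ℂ} (hp : p.re ∈ interior (integrableExpSet ζ P))
    (h0 : lundbergFun P β ζ p = 0) (h1 : lundbergDeriv P β ζ p ≠ 0) :
    Tendsto (fun u => (u - p) * (lundbergFun P β ζ u)⁻¹) (𝓝[≠] p) (𝓝 (lundbergDeriv P β ζ p)⁻¹) := by
  have := (hasDerivAt_iff_tendsto_slope.1 (hasDerivAt_lundbergFun (β := β) hp)).inv₀ h1
  refine this.congr fun u => ?_
  rw [slope_def_field, h0, sub_zero, inv_div, div_eq_mul_inv]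

variable [IsProbabilityMeasure P]

/-- To the left of κ the transform has modulus at most its value at Re u, which is strictly below
its value 1 at κ. -/
theorem lundbergFun_ne_zero_of_re_lt (hβ : 0 < α / c) (hm : Measurable ζ) (hζ : ∀ᵐ ω ∂P, 0 ≤ ζ ω)
    (hκ0 : 0 < κ) (hκ : lundbergTransform P α c ζ κ = 1) (hr : 0 < r)
    (hlight : ∀ s < κ + r, Integrable (fun ω => Real.exp (s * ζ ω)) P) {u : ℂ} (hu : u.re < κ)
    (hu0 : u ≠ 0) : lundbergFun P (α / c) ζ u ≠ 0 := by
  have hR0 : 0 < κ + r := by linarith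
  have hκr : realLundbergTransform P α c ζ κ = 1 := by
    rw [lundbergTransform_ofReal] at hκ; exact_mod_cast hκ
  rw [lundbergFun_eq hR0 hm hζ hlight (by linarith)]
  refine mul_ne_zero hu0 fun h => ?_
  have h1 := norm_lundbergTransform_le (P := P) (ζ := ζ) hβ.le u
  have h2 := realLundbergTransform_lt hR0 hm hζ hlight hβ hu (by linarith) (by rw [hκr]; simp)
  rw [← sub_eq_zero.1 h, norm_one] at h1
  linarith

/-- If z₁ were purely imaginary, the real parts of the two Lundberg equations would force cos(Im z₁
· ζ) = 1 almost surely; then e^{z₁ζ} = 1, the moment generating functions at κ and κ + z₁ coincide,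
and so do κ and κ + z₁. A real z₁ is excluded by strict monotonicity on the real axis. No
non-lattice assumption is needed. -/
theorem root_re_pos_im_ne (hβ : 0 < α / c) (hm : Measurable ζ) (hζ : ∀ᵐ ω ∂P, 0 ≤ ζ ω)
    (hκ0 : 0 < κ) (hκ : lundbergTransform P α c ζ κ = 1)
    (hlight : ∀ s < κ + r, Integrable (fun ω => Real.exp (s * ζ ω)) P) (hz : z₁ ≠ 0)
    (hre : 0 ≤ z₁.re) (hrer : z₁.re < r) (h1 : lundbergTransform P α c ζ (κ + z₁) = 1) :
    0 < z₁.re ∧ z₁.im ≠ 0 := by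
  have hr : 0 < r := hre.trans_lt hrer
  have hR0 : 0 < κ + r := by linarith
  have hκr : realLundbergTransform P α c ζ κ = 1 := by
    rw [lundbergTransform_ofReal] at hκ; exact_mod_cast hκ
  constructor
  · refine lt_of_le_of_ne hre fun h0 => ?_
    have hre' : (κ + z₁).re = κ := by simp [← h0]
    have hzI : z₁ = z₁.im * Complex.I := by
      apply Complex.ext <;> simp [← h0]
    have e1 := lundbergTransform_mul (α := α) (c := c) hR0 hm hζ hlight (u := κ + z₁) (by rw [hre']; linarith)
    have e2 := lundbergTransform_mul (α := α) (c := c) hR0 hm hζ hlight (u := κ) (by simpa using hr)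
    rw [h1, one_mul] at e1
    rw [hκ, one_mul] at e2
    have hi : Integrable (fun ω => Real.exp (κ * ζ ω)) P := hlight κ (by linarith)
    have hic : Integrable (fun ω => Complex.exp ((κ + z₁) * ζ ω)) P :=
      (integrable_norm_iff (by fun_prop)).1 (hi.congr (Eventually.of_forall fun ω => by
        simp [Complex.norm_exp, ← h0]))
    have hexp : ∀ ω, (Complex.exp ((κ + z₁) * ζ ω)).re = Real.exp (κ * ζ ω) * Real.cos (z₁.im * ζ ω) :=
      fun ω => by rw [Complex.exp_re]; simp [← h0]
    have hReq : (complexMGF ζ P (κ + z₁)).re = (complexMGF ζ P κ).re := by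
      have r1 := congrArg Complex.re e1
      have r2 := congrArg Complex.re e2
      rw [hre', Complex.re_ofReal_mul, Complex.sub_re] at r1
      rw [Complex.ofReal_re, Complex.re_ofReal_mul, Complex.sub_re] at r2
      have := mul_left_cancel₀ hβ.ne' (r1.symm.trans r2)
      linarith
    rw [complexMGF_ofReal, Complex.ofReal_re, complexMGF] at hReq
    have hre2 : ∫ ω, (Complex.exp ((κ + z₁) * ζ ω)).re ∂P = (∫ ω, Complex.exp ((κ + z₁) * ζ ω) ∂P).re :=
      integral_re hic
    rw [← hre2, mgf] at hReq
    have hnn : 0 ≤ᵐ[P] fun ω => Real.exp (κ * ζ ω) - (Complex.exp ((κ + z₁) * ζ ω)).re := by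
      refine Eventually.of_forall fun ω => ?_
      simp only [Pi.zero_apply, hexp]
      nlinarith [Real.exp_pos (κ * ζ ω), Real.cos_le_one (z₁.im * ζ ω)]
    have hzero : ∫ ω, (Real.exp (κ * ζ ω) - (Complex.exp ((κ + z₁) * ζ ω)).re) ∂P = 0 := by
      have hicr : Integrable (fun ω => (Complex.exp ((κ + z₁) * ζ ω)).re) P := hic.re
      rw [integral_sub hi hicr]; exact sub_eq_zero.2 hReq.symm
    rw [integral_eq_zero_iff_of_nonneg_ae hnn (hi.sub hic.re)] at hzero
    have hMeq : complexMGF ζ P (κ + z₁) = complexMGF ζ P κ := by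
      refine integral_congr_ae ?_
      filter_upwards [hzero] with ω hω
      simp only [Pi.zero_apply, hexp] at hω
      have hcos : Real.cos (z₁.im * ζ ω) = 1 := by
        have : Real.exp (κ * ζ ω) * (1 - Real.cos (z₁.im * ζ ω)) = 0 := by linarith
        have := (mul_eq_zero.1 this).resolve_left (Real.exp_pos _).ne'
        linarith
      have hsin : Real.sin (z₁.im * ζ ω) = 0 := by
        have := Real.sin_sq_add_cos_sq (z₁.im * ζ ω)
        rw [hcos] at this
        exact pow_eq_zero_iff two_ne_zero |>.1 (by linarith)
      rw [add_mul, Complex.exp_add]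
      have : Complex.exp (z₁ * ζ ω) = 1 := by
        rw [hzI, mul_right_comm, ← Complex.ofReal_mul, Complex.exp_mul_I, ← Complex.ofReal_cos,
          ← Complex.ofReal_sin, hcos, hsin]
        simp
      rw [this, mul_one]
    rw [hMeq, ← e2] at e1
    exact hz (by simpa using e1)
  · intro him
    have hzr : z₁ = (z₁.re : ℂ) := by apply Complex.ext <;> simp [him]
    have hpos : 0 < z₁.re := lt_of_le_of_ne hre fun h => hz (by rw [hzr, ← h]; simp)
    have hk : realLundbergTransform P α c ζ (κ + z₁.re) = 1 := by
      rw [hzr, ← Complex.ofReal_add, lundbergTransform_ofReal] at h1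
      exact_mod_cast h1
    have := realLundbergTransform_lt hR0 hm hζ hlight hβ (s := κ) (t := κ + z₁.re) (by linarith)
      (by linarith) (by rw [hk]; simp)
    linarith

/-- The derivative at the adjustment coefficient. -/
theorem exists_lundbergDeriv_adjustment (hβ : 0 < α / c) (hm : Measurable ζ) (hζ : ∀ᵐ ω ∂P, 0 ≤ ζ ω)
    (hi : Integrable ζ P) (hκ0 : 0 < κ) (hκ : lundbergTransform P α c ζ κ = 1) (hr : 0 < r)
    (hlight : ∀ s < κ + r, Integrable (fun ω => Real.exp (s * ζ ω)) P) :
    ∃ d : ℝ, lundbergDeriv P (α / c) ζ κ = -(d : ℂ) ∧ 1 - α / c * ∫ ω, ζ ω ∂P ≤ d := by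
  have hR0 : 0 < κ + r := by linarith
  have e2 := lundbergTransform_mul (α := α) (c := c) hR0 hm hζ hlight (u := κ) (by simpa using hr)
  rw [hκ, one_mul, complexMGF_ofReal] at e2
  have e3 : κ = α / c * (mgf ζ P κ - 1) := by exact_mod_cast e2
  have hint : Integrable (fun ω => ζ ω * Real.exp (κ * ζ ω)) P := by
    have := integrable_pow_mul_exp_of_mem_interior_integrableExpSet
      (mem_interior_integrableExpSet hlight (s := κ) (by linarith)) 1
    simpa using this
  have hi0 : Integrable (fun ω => Real.exp (κ * ζ ω)) P := hlight κ (by linarith)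
  refine ⟨α / c * (∫ ω, ζ ω * Real.exp (κ * ζ ω) ∂P) - 1, ?_, ?_⟩
  · have : ∫ ω, (ζ ω : ℂ) * Complex.exp (κ * ζ ω) ∂P = ((∫ ω, ζ ω * Real.exp (κ * ζ ω) ∂P : ℝ) : ℂ) := by
      rw [← integral_complex_ofReal]
      congr 1
      ext ω
      push_cast
      rfl
    rw [lundbergDeriv, this]
    push_cast
    ring
  · have hineq : ∫ ω, 2 * (Real.exp (κ * ζ ω) - 1) ∂P ≤
        ∫ ω, κ * (ζ ω * Real.exp (κ * ζ ω) + ζ ω) ∂P := by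
      refine integral_mono_ae ((hi0.sub (integrable_const 1)).const_mul 2)
        ((hint.add hi).const_mul κ) ?_
      filter_upwards [hζ] with ω hω
      have := two_mul_exp_sub_one_le (mul_nonneg hκ0.le hω)
      linarith
    rw [integral_const_mul, integral_const_mul, integral_add hint hi,
      integral_sub hi0 (integrable_const 1)] at hineq
    simp only [integral_const, probReal_univ, smul_eq_mul, mul_one] at hineq
    change 2 * (mgf ζ P κ - 1) ≤ _ at hineq
    have h4 := mul_le_mul_of_nonneg_left hineq hβ.le
    have h5 : 2 * κ ≤ κ * (α / c * (∫ ω, ζ ω * Real.exp (κ * ζ ω) ∂P) + α / c * ∫ ω, ζ ω ∂P) := by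
      linarith
    rw [mul_comm 2 κ] at h5
    have h6 := le_of_mul_le_mul_left h5 hκ0
    linarith

/-- Near z₁ one has g(z) = 1 - D(κ + z)/(κ + z). Since D(κ + z₁) = 0, a zero of D' there would make
g'(z₁) vanish. -/
theorem lundbergDeriv_ne_zero_of_deriv_tiltedMGF (hm : Measurable ζ) (hζ : ∀ᵐ ω ∂P, 0 ≤ ζ ω)
    (hκ0 : 0 < κ) (hlight : ∀ s < κ + r, Integrable (fun ω => Real.exp (s * ζ ω)) P)
    (hre : 0 ≤ z₁.re) (hrer : z₁.re < r) (h1 : lundbergTransform P α c ζ (κ + z₁) = 1)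
    (hsimple : deriv (tiltedMGF P α c ζ κ) z₁ ≠ 0) : lundbergDeriv P (α / c) ζ (κ + z₁) ≠ 0 := by
  intro h0
  have hR0 : 0 < κ + r := by linarith
  have hlt : (κ + z₁).re < κ + r := by simpa using hrer
  have hne : (κ : ℂ) + z₁ ≠ 0 := fun h => by
    have := congrArg Complex.re h
    simp at this
    linarith
  have hD0 : lundbergFun P (α / c) ζ (κ + z₁) = 0 := by
    rw [lundbergFun_eq hR0 hm hζ hlight hlt, h1]; simp
  have hD := hasDerivAt_lundbergFun (β := α / c) (mem_interior_integrableExpSet hlight hlt)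
  have hadd : HasDerivAt (fun z : ℂ => (κ : ℂ) + z) 1 z₁ := (hasDerivAt_id z₁).const_add _
  have hcomp := (hD.comp z₁ hadd).div hadd hne
  simp only [Function.comp_apply] at hcomp
  have heq : tiltedMGF P α c ζ κ =ᶠ[𝓝 z₁]
      fun z => 1 - lundbergFun P (α / c) ζ (κ + z) / (κ + z) := by
    have hc1 : ContinuousAt (fun z : ℂ => ((κ : ℂ) + z).re) z₁ := by fun_prop
    have hc2 : ContinuousAt (fun z : ℂ => (κ : ℂ) + z) z₁ := by fun_prop
    filter_upwards [hc1.eventually_lt_const hlt, hc2.eventually_ne hne] with z hz1 hz2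
    rw [tiltedMGF, lundbergFun_eq hR0 hm hζ hlight hz1, mul_div_cancel_left₀ _ hz2]
    ring
  refine hsimple ?_
  rw [heq.deriv_eq]
  have := (hcomp.const_sub 1).deriv
  rw [h0, hD0] at this
  simpa [Function.comp_def] using this

end

/-! ### The two-term expansion for one company -/

section

variable {Ω : Type*} [MeasurableSpace Ω] {P : Measure Ω} {α c κ r : ℝ} {ζ : Ω → ℝ} {z₁ : ℂ}

theorem norm_complexMGF_sub_one_le [IsProbabilityMeasure P] {b : ℝ} (hζ : ∀ᵐ ω ∂P, 0 ≤ ζ ω)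
    (hb : Integrable (fun ω => Real.exp (b * ζ ω)) P) {u : ℂ} (hu : u.re ≤ b) :
    ‖complexMGF ζ P u - 1‖ ≤ mgf ζ P b + 1 := by
  refine (norm_sub_le _ _).trans ?_
  rw [norm_one]
  refine add_le_add_left (norm_complexMGF_le_mgf.trans ?_) 1
  refine integral_mono_of_nonneg (Eventually.of_forall fun _ => (Real.exp_pos _).le) hb ?_
  filter_upwards [hζ] with ω hω
  exact Real.exp_le_exp.2 (mul_le_mul_of_nonneg_right hu hω)

/-- Away from the real axis, `1 / lundbergFun` is close to `1 / u`. -/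
theorem norm_inv_lundbergFun_sub_inv_le [IsProbabilityMeasure P] {b β : ℝ} (hβ : 0 < β)
    (hζ : ∀ᵐ ω ∂P, 0 ≤ ζ ω) (hb : Integrable (fun ω => Real.exp (b * ζ ω)) P) {u : ℂ} (hu : u.re ≤ b)
    (him : 2 * (β * (mgf ζ P b + 1)) + 1 ≤ |u.im|) :
    ‖(lundbergFun P β ζ u)⁻¹ - u⁻¹‖ ≤ 4 * (β * (mgf ζ P b + 1)) * (1 + u.im ^ 2)⁻¹ := by
  have hu' := Complex.abs_im_le_norm u
  set A := β * (mgf ζ P b + 1) with hA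
  have hA0 : 0 ≤ A := mul_nonneg hβ.le (add_nonneg mgf_nonneg zero_le_one)
  have hM : ‖(β : ℂ) * (complexMGF ζ P u - 1)‖ ≤ A := by
    rw [norm_mul, Complex.norm_real, Real.norm_of_nonneg hβ.le]
    exact mul_le_mul_of_nonneg_left (norm_complexMGF_sub_one_le hζ hb hu) hβ.le
  have h1 : |u.im| / 2 ≤ ‖lundbergFun P β ζ u‖ := by
    have := norm_sub_norm_le u ((β : ℂ) * (complexMGF ζ P u - 1))
    rw [lundbergFun]
    linarith
  have hne : lundbergFun P β ζ u ≠ 0 := norm_pos_iff.1 (by linarith)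
  have hu0 : u ≠ 0 := norm_pos_iff.1 (by linarith)
  have hsub : u - lundbergFun P β ζ u = (β : ℂ) * (complexMGF ζ P u - 1) := by
    rw [lundbergFun, sub_sub_cancel]
  rw [inv_sub_inv hne hu0, hsub, norm_div, norm_mul (lundbergFun P β ζ u), ← div_eq_mul_inv]
  have h2 : |u.im| / 2 * |u.im| ≤ ‖lundbergFun P β ζ u‖ * ‖u‖ :=
    mul_le_mul h1 hu' (abs_nonneg _) (norm_nonneg _)
  have h3 : u.im ^ 2 = |u.im| ^ 2 := (sq_abs _).symm
  have h4 : 1 + u.im ^ 2 ≤ 4 * (‖lundbergFun P β ζ u‖ * ‖u‖) := by nlinarith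
  rw [div_le_div_iff₀ (mul_pos (by linarith) (by linarith)) (by positivity)]
  calc _ ≤ A * (1 + u.im ^ 2) := mul_le_mul_of_nonneg_right hM (by positivity)
    _ ≤ A * (4 * (‖lundbergFun P β ζ u‖ * ‖u‖)) := mul_le_mul_of_nonneg_left h4 hA0
    _ = _ := by ring

/-- The two-term expansion of a one-dimensional ruin probability. -/
theorem exists_abs_ruin_sub_le [IsProbabilityMeasure P] (hα : 0 < α) (hc : 0 < c) (hm : Measurable ζ)
    (hζ : ∀ᵐ ω ∂P, 0 ≤ ζ ω) (hi : Integrable ζ P) (hdrift : 0 < c - α * ∫ ω, ζ ω ∂P) (hκ0 : 0 < κ)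
    (hκ : lundbergTransform P α c ζ κ = 1)
    (hlight : ∀ s < κ + r, Integrable (fun ω => Real.exp (s * ζ ω)) P) (hz : z₁ ≠ 0)
    (hroots : {z : ℂ | 0 ≤ z.re ∧ z.re < r ∧ tiltedMGF P α c ζ κ z = 1} = {0, z₁, conj z₁})
    (hsimple : deriv (tiltedMGF P α c ζ κ) z₁ ≠ 0) :
    ∃ b K : ℝ, κ + z₁.re < b ∧ ∀ x : ℝ, 0 ≤ x →
      |1 - survivalProb (expMeasure α) (P.map ζ) c x -
        ((ruinCoeff P α c ζ κ z₁ 0 * Complex.exp (-ruinExponent κ z₁ 0 * x)).re +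
          (ruinCoeff P α c ζ κ z₁ 1 * Complex.exp (-ruinExponent κ z₁ 1 * x)).re)| ≤
        K * Real.exp (-b * x) := by
  classical
  have := Measure.isProbabilityMeasure_map (μ := P) hm.aemeasurable
  have := isProbabilityMeasure_expMeasure hα
  have hβ : 0 < α / c := div_pos hα hc
  obtain ⟨hre, hrer, h1⟩ : z₁ ∈ {z : ℂ | 0 ≤ z.re ∧ z.re < r ∧ tiltedMGF P α c ζ κ z = 1} := by
    rw [hroots]; simp
  rw [tiltedMGF] at h1
  have hr : 0 < r := hre.trans_lt hrer
  have hR0 : 0 < κ + r := by linarith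
  obtain ⟨hzre, hzim⟩ := root_re_pos_im_ne hβ hm hζ hκ0 hκ hlight hz hre hrer h1
  set φ := survivalProb (expMeasure α) (P.map ζ) c with hφ
  set μ₀ : ℝ := 1 - α / c * ∫ ω, ζ ω ∂P with hμ₀
  have hμpos : 0 < μ₀ := by
    have : μ₀ = (c - α * ∫ ω, ζ ω ∂P) / c := by rw [hμ₀]; field_simp
    rw [this]; exact div_pos hdrift hc
  have hφ0 : φ 0 = μ₀ := survivalProb_zero hα hc hm hζ hi
    (mem_interior_integrableExpSet hlight hR0) hdrift
  set D := lundbergFun P (α / c) ζ with hD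
  set D' := lundbergDeriv P (α / c) ζ with hD'
  set s₁ : ℂ := κ + z₁ with hs₁
  have hs₁re : s₁.re = κ + z₁.re := by simp [hs₁]
  have hs₁im : s₁.im = z₁.im := by simp [hs₁]
  have hfac : ∀ u : ℂ, u.re < κ + r → D u = u * (1 - lundbergTransform P α c ζ u) := fun u hu =>
    lundbergFun_eq hR0 hm hζ hlight hu
  -- The point 0 is listed although it turns out to be removable: the formula for the transform is
  -- singular there term by term.
  set S : Finset ℂ := {0, (κ : ℂ), s₁, conj s₁} with hS
  have hSre : ∀ p ∈ S, 0 ≤ p.re ∧ p.re < κ + r := fun p hp => by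
    simp only [hS, Finset.mem_insert, Finset.mem_singleton] at hp
    rcases hp with rfl | rfl | rfl | rfl
    · exact ⟨le_rfl, hR0⟩
    · exact ⟨hκ0.le, by simpa using hr⟩
    · rw [hs₁re]; constructor <;> linarith
    · rw [Complex.conj_re, hs₁re]; constructor <;> linarith
  have hD0 : ∀ p ∈ S, D p = 0 := fun p hp => by
    simp only [hS, Finset.mem_insert, Finset.mem_singleton] at hp
    have h3 : D s₁ = 0 := by rw [hfac s₁ (by rw [hs₁re]; linarith), h1]; simp
    rcases hp with rfl | rfl | rfl | rfl
    · exact lundbergFun_zero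
    · rw [hfac κ (by simpa using hr), hκ]; simp
    · exact h3
    · rw [hD, lundbergFun_conj, ← hD, h3, map_zero]
  have hD'0 : D' 0 = μ₀ := lundbergDeriv_zero
  have hD'ne : ∀ p ∈ S, D' p ≠ 0 := fun p hp => by
    simp only [hS, Finset.mem_insert, Finset.mem_singleton] at hp
    have h3 : D' s₁ ≠ 0 :=
      lundbergDeriv_ne_zero_of_deriv_tiltedMGF hm hζ hκ0 hlight hre hrer h1 hsimple
    rcases hp with rfl | rfl | rfl | rfl
    · rw [hD'0]; exact Complex.ofReal_ne_zero.2 hμpos.ne'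
    · obtain ⟨d, hd, hdle⟩ := exists_lundbergDeriv_adjustment hβ hm hζ hi hκ0 hκ hr hlight
      rw [hD', hd, neg_ne_zero]
      exact Complex.ofReal_ne_zero.2 (hμpos.trans_le hdle).ne'
    · exact h3
    · rw [hD', lundbergDeriv_conj]; exact (map_ne_zero _).2 h3
  have hzero : ∀ u : ℂ, u.re < κ + r → u ∉ S → D u ≠ 0 := fun u hu huS h => by
    simp only [hS, Finset.mem_insert, Finset.mem_singleton, not_or] at huS
    by_cases huκ : u.re < κ
    · exact lundbergFun_ne_zero_of_re_lt hβ hm hζ hκ0 hκ hr hlight huκ huS.1 h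
    · rw [hfac u hu] at h
      have hH := sub_eq_zero.1 ((mul_eq_zero.1 h).resolve_left huS.1)
      have hmem : u - κ ∈ {z : ℂ | 0 ≤ z.re ∧ z.re < r ∧ tiltedMGF P α c ζ κ z = 1} :=
        ⟨by simpa using huκ, by simp; linarith, by rw [tiltedMGF, add_sub_cancel, hH]⟩
      rw [hroots] at hmem
      rcases hmem with h | h | h
      · exact huS.2.1 (sub_eq_zero.1 h)
      · exact huS.2.2.1 (by rw [hs₁, ← h]; ring)
      · refine huS.2.2.2 ?_
        rw [Set.mem_singleton_iff] at h
        rw [hs₁, map_add, Complex.conj_ofReal, ← h]; ring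
  -- The midpoint between κ + Re z₁ and κ + r: beyond the last pole, but still inside the region of
  -- convergence.
  set b : ℝ := κ + (z₁.re + r) / 2 with hb
  have hbR : b < κ + r := by rw [hb]; linarith
  have hb1 : κ + z₁.re < b := by rw [hb]; linarith
  -- The negatives of the residues. At 0 the poles of -1/u and φ(0)/D(u) cancel because φ(0) = D'(0)
  -- = μ₀.
  set C : ℂ → ℂ := fun p => if p = 0 then 0 else -(μ₀ : ℂ) * (D' p)⁻¹ with hC
  set A := α / c * (mgf ζ P b + 1) with hA
  -- The starting line Re u = -β/2, with β = α/c, lies inside the strip -β < Re u < 0 where the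
  -- transform identity holds; K and T come from `norm_inv_lundbergFun_sub_inv_le`.
  obtain ⟨K, hK⟩ := exists_norm_sub_sum_le_of_laplace (f := fun x => ((1 - φ x : ℝ) : ℂ)) (B := 1)
    (σ := α / c / 2) (b := b) (R := κ + r) (K := μ₀ * (4 * A)) (T := 2 * A + 1)
    (W := fun u => -u⁻¹ + φ 0 * (D u)⁻¹)
    (Complex.continuous_ofReal.comp_continuousOn (continuousOn_const.sub
      (continuousOn_survivalProb hα hc ((ae_map_iff hm.aemeasurable measurableSet_Ici).2 hζ))))
    (fun x _ => by
      rw [Complex.norm_real, Real.norm_of_nonneg (sub_nonneg.2 (survivalProb_le_one x))]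
      linarith [survivalProb_nonneg (τ := expMeasure α) (ν := P.map ζ) (c := c) x])
    (half_pos hβ) (by linarith) hbR S (fun p hp => (hSre p hp).1) (fun p hp => (hSre p hp).2) C
    (fun u hu => by
      have hu0 : u ≠ 0 := fun h => hu.2 (by simp [hS, h])
      have hDd := (hasDerivAt_lundbergFun (β := α / c)
        (mem_interior_integrableExpSet hlight hu.1)).differentiableAt
      exact ((differentiableAt_inv hu0).neg.add ((hDd.inv (hzero u hu.1 hu.2)).const_mul
        _)).differentiableWithinAt)
    (fun p hp => by
      have ht := (tendsto_sub_mul_inv_lundbergFun (β := α / c) (mem_interior_integrableExpSet hlight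
        (hSre p hp).2) (hD0 p hp) (hD'ne p hp)).const_mul (φ 0 : ℂ)
      have ht2 : Tendsto (fun u : ℂ => (u - p) * -u⁻¹) (𝓝[≠] p) (𝓝 (if p = 0 then -1 else 0)) := by
        split_ifs with h0
        · subst h0
          refine tendsto_const_nhds.congr' ?_
          filter_upwards [self_mem_nhdsWithin] with u hu
          rw [sub_zero, mul_neg, mul_inv_cancel₀ hu]
        · have hcont : ContinuousAt (fun u : ℂ => (u - p) * -u⁻¹) p :=
            ContinuousAt.mul (by fun_prop) (continuousAt_inv₀ h0).neg
          simpa [ContinuousAt] using hcont.tendsto.mono_left nhdsWithin_le_nhds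
      have hval : (if p = 0 then (-1 : ℂ) else 0) + φ 0 * (D' p)⁻¹ = -C p := by
        simp only [hC, hφ0]
        split_ifs with h0
        · rw [h0, hD'0, mul_inv_cancel₀ (Complex.ofReal_ne_zero.2 hμpos.ne')]; simp
        · ring
      rw [← hval]
      refine (ht2.add ht).congr fun u => ?_
      ring)
    (fun u _ h2 h3 => by
      have hbd := norm_inv_lundbergFun_sub_inv_le hβ hζ (hlight b hbR) h2 h3
      have e : -u⁻¹ + φ 0 * (D u)⁻¹ + ((1 - φ 0 : ℝ) : ℂ) * u⁻¹ = φ 0 * ((D u)⁻¹ - u⁻¹) := by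
        push_cast; ring
      rw [e, norm_mul, Complex.norm_real, hφ0, Real.norm_of_nonneg hμpos.le, mul_assoc]
      exact mul_le_mul_of_nonneg_left hbd hμpos.le)
    (fun t => by
      have hure : (-((α / c / 2 : ℝ) : ℂ) + t * Complex.I).re = -(α / c / 2) := by simp
      refine integral_cexp_mul_one_sub_survivalProb hα hc hm hζ (by rw [hure]; linarith)
        (by rw [hure]; linarith) ?_
      refine lundbergFun_ne_zero_of_re_lt hβ hm hζ hκ0 hκ hr hlight (by rw [hure]; linarith) fun h => ?_
      rw [h] at hure
      simp only [Complex.zero_re] at hure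
      linarith)
  refine ⟨b, K, hb1, fun x hx => ?_⟩
  refine le_trans ?_ (hK x hx)
  rw [← Real.norm_eq_abs, ← Complex.norm_real]
  refine le_of_eq (congrArg norm ?_)
  have hκne : (κ : ℂ) ≠ 0 := Complex.ofReal_ne_zero.2 hκ0.ne'
  have hs₁ne : s₁ ≠ 0 := fun h => hzim (by rw [← hs₁im, h]; simp)
  have hcs₁ne : conj s₁ ≠ 0 := (map_ne_zero _).2 hs₁ne
  have hcs₁im : (conj s₁).im = -z₁.im := by rw [Complex.conj_im, hs₁im]
  have hκs : (κ : ℂ) ≠ s₁ := fun h => hzim (by rw [← hs₁im, ← h]; simp)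
  have hκcs : (κ : ℂ) ≠ conj s₁ := fun h => hzim (by
    rw [← neg_eq_zero, ← hcs₁im, ← h]; simp)
  have hss : s₁ ≠ conj s₁ := fun h => hzim (by
    have := congrArg Complex.im h
    rw [hcs₁im, hs₁im] at this
    linarith)
  have hres : ∀ w : ℂ, ruinResidue P α c ζ w = -(μ₀ : ℂ) * (D' w)⁻¹ := fun w => ruinResidue_eq hc w
  have hsum : ∑ p ∈ S, C p * Complex.exp (-p * x) =
      ruinResidue P α c ζ κ * Complex.exp (-κ * x) + (ruinResidue P α c ζ s₁ * Complex.exp (-s₁ * x) +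
        conj (ruinResidue P α c ζ s₁ * Complex.exp (-s₁ * x))) := by
    rw [hS, Finset.sum_insert (by simp [hκne.symm, hs₁ne.symm, hcs₁ne.symm]),
      Finset.sum_insert (by simp [hκs, hκcs]), Finset.sum_insert (by simpa using hss),
      Finset.sum_singleton]
    have hconj : conj (ruinResidue P α c ζ s₁ * Complex.exp (-s₁ * x)) =
        C (conj s₁) * Complex.exp (-conj s₁ * x) := by
      simp only [hC, if_neg hcs₁ne, hres, map_mul, map_neg, Complex.conj_ofReal, map_inv₀, hD',
        lundbergDeriv_conj, ← Complex.exp_conj]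
    rw [hconj]
    simp only [hC, if_neg hκne, if_neg hs₁ne, if_true, hres, zero_mul, zero_add]
  have hreal : ∃ C₀ : ℝ, ruinResidue P α c ζ κ = C₀ := by
    obtain ⟨d, hd, -⟩ := exists_lundbergDeriv_adjustment hβ hm hζ hi hκ0 hκ hr hlight
    exact ⟨μ₀ / d, by rw [hres, hD', hd]; push_cast; rw [inv_neg, neg_mul_neg, div_eq_mul_inv]⟩
  obtain ⟨C₀, hC₀⟩ := hreal
  have hterm0 : ((ruinCoeff P α c ζ κ z₁ 0 * Complex.exp (-ruinExponent κ z₁ 0 * x)).re : ℂ) =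
      ruinResidue P α c ζ κ * Complex.exp (-κ * x) := by
    simp only [ruinCoeff, ruinExponent, Matrix.cons_val_zero]
    rw [hC₀, ← Complex.ofReal_neg, ← Complex.ofReal_mul, ← Complex.ofReal_exp, ← Complex.ofReal_mul,
      Complex.ofReal_re]
  have hterm1 : ((ruinCoeff P α c ζ κ z₁ 1 * Complex.exp (-ruinExponent κ z₁ 1 * x)).re : ℂ) =
      ruinResidue P α c ζ s₁ * Complex.exp (-s₁ * x) +
        conj (ruinResidue P α c ζ s₁ * Complex.exp (-s₁ * x)) := by
    simp only [ruinCoeff, ruinExponent, Matrix.cons_val_one, Matrix.cons_val_fin_one]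
    rw [Complex.add_conj, ← hs₁, mul_assoc, ← Complex.ofReal_ofNat, Complex.re_ofReal_mul]
  rw [Complex.ofReal_sub, Complex.ofReal_add, hterm0, hterm1, hsum]

/-- The leading coefficient lies in `(0, 1]`. -/
theorem exists_ruinResidue_adjustment [IsProbabilityMeasure P] (hα : 0 < α) (hc : 0 < c)
    (hm : Measurable ζ) (hζ : ∀ᵐ ω ∂P, 0 ≤ ζ ω) (hi : Integrable ζ P)
    (hdrift : 0 < c - α * ∫ ω, ζ ω ∂P) (hκ0 : 0 < κ) (hκ : lundbergTransform P α c ζ κ = 1)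
    (hr : 0 < r) (hlight : ∀ s < κ + r, Integrable (fun ω => Real.exp (s * ζ ω)) P) :
    ∃ C₀ : ℝ, ruinResidue P α c ζ κ = C₀ ∧ 0 < C₀ ∧ C₀ ≤ 1 := by
  obtain ⟨d, hd, hdle⟩ := exists_lundbergDeriv_adjustment (div_pos hα hc) hm hζ hi hκ0 hκ hr hlight
  have hpos : 0 < 1 - α / c * ∫ ω, ζ ω ∂P := by
    have : 1 - α / c * ∫ ω, ζ ω ∂P = (c - α * ∫ ω, ζ ω ∂P) / c := by field_simp
    rw [this]; exact div_pos hdrift hc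
  have hd0 := hpos.trans_le hdle
  refine ⟨(1 - α / c * ∫ ω, ζ ω ∂P) / d, ?_, div_pos hpos hd0, (div_le_one hd0).2 hdle⟩
  rw [ruinResidue_eq hc, hd, inv_neg, neg_mul_neg, Complex.ofReal_div]
  exact (div_eq_mul_inv _ _).symm

end

/-! ### From the risk process to the random walk -/

/-- The time of the `n`-th arrival, read off from a counting path along rational times. -/
noncomputable def arrivalTime (n : ℕ) (f : ℝ≥0 → ℕ) : ℝ≥0∞ :=
  ⨅ q : ℚ≥0, if n ≤ f (q : ℝ≥0) then ((q : ℝ≥0) : ℝ≥0∞) else ⊤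

theorem measurable_arrivalTime (n : ℕ) : Measurable (arrivalTime n) := by
  refine Measurable.iInf fun q => Measurable.ite ?_ measurable_const measurable_const
  exact measurable_pi_apply (q : ℝ≥0) (measurableSet_Ici (a := n))

/-- Density of the rationals makes the countable infimum equal to the true arrival time, while
countability keeps it measurable in the path. -/
theorem arrivalTime_toReal {n : ℕ} {f : ℝ≥0 → ℕ} {s : ℝ} (hs : 0 ≤ s)
    (h : ∀ t : ℝ≥0, n ≤ f t ↔ s ≤ t) : (arrivalTime n f).toReal = s := by
  lift s to ℝ≥0 using hs
  have : arrivalTime n f = s := by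
    refine le_antisymm (le_of_forall_gt fun b hb => ?_) (le_iInf fun q => ?_)
    · obtain ⟨q, hq0, hsq, hqb⟩ := ENNReal.lt_iff_exists_rat_btwn.1 hb
      lift q to ℚ≥0 using hq0
      have hcast : Real.toNNReal ((q : ℚ) : ℝ) = (q : ℝ≥0) := by
        refine NNReal.eq ?_
        rw [Real.coe_toNNReal _ (by positivity)]
        norm_cast
      rw [hcast] at hsq hqb
      refine (iInf_le_of_le q ?_).trans_lt hqb
      rw [if_pos ((h _).2 ?_)]
      exact_mod_cast hsq.le
    · split_ifs with hq
      · exact_mod_cast (h _).1 hq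
      · exact le_top
  rw [this, ENNReal.coe_toReal]

/-- Ruin can only occur at a claim time. -/
theorem isRuined_iff {Ω : Type*} {c x : ℝ} {N : ℝ≥0 → Ω → ℕ} {Z : ℕ → Ω → ℝ} {T : ℕ → ℝ} {ω : Ω}
    (hc : 0 < c) (hZ : ∀ k, 0 ≤ Z k ω) (hT : ∀ k, 0 < T k)
    (hN : ∀ (t : ℝ≥0) (n : ℕ), n ≤ N t ω ↔ ∑ k ∈ Finset.range n, T k ≤ (t : ℝ)) :
    IsRuined c x N Z ω ↔ ¬ ∀ n : ℕ, ∑ k ∈ Finset.range n, (Z k ω - c * T k) ≤ x := by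
  rw [IsRuined, iInf_lt_iff]
  push Not
  simp only [Finset.sum_sub_distrib, ← Finset.mul_sum]
  constructor
  · rintro ⟨t, ht⟩
    have ht' : riskProcess c x N Z t ω < 0 := by exact_mod_cast ht
    -- The claims counted at time t have all arrived by t, and the premium earned after the last of
    -- them can only raise the capital.
    refine ⟨N t ω, ?_⟩
    have h1 := mul_le_mul_of_nonneg_left ((hN t (N t ω)).1 le_rfl) hc.le
    rw [riskProcess] at ht'
    linarith
  · rintro ⟨n, hn⟩
    have hS : 0 ≤ ∑ k ∈ Finset.range n, T k := Finset.sum_nonneg fun k _ => (hT k).le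
    obtain ⟨t, ht⟩ : ∃ t : ℝ≥0, (t : ℝ) = ∑ k ∈ Finset.range n, T k := ⟨⟨_, hS⟩, rfl⟩
    refine ⟨t, ?_⟩
    -- At the n-th arrival time at least n claims are counted, and any further ones are nonnegative.
    have hsum := Finset.sum_le_sum_of_subset_of_nonneg (f := fun k => Z k ω)
      (Finset.range_subset_range.2 ((hN t n).2 ht.ge)) fun k _ _ => hZ k
    have : riskProcess c x N Z t ω < 0 := by
      rw [riskProcess, ht]
      linarith
    exact_mod_cast this

section

variable {Ω : Type*} [MeasurableSpace Ω] {P : Measure Ω} {α c : ℝ} {N : ℝ≥0 → Ω → ℕ}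
  {Z : ℕ → Ω → ℝ}

/-- The interarrival times of a risk model are independent of the claims. -/
theorem IsRiskModel.exists_interarrival_indep (h : IsRiskModel P α c N Z) :
    ∃ T : ℕ → Ω → ℝ, (∀ n, Measurable (T n)) ∧ iIndepFun T P ∧ (∀ n, P.map (T n) = expMeasure α) ∧
      IndepFun (fun ω n => T n ω) (fun ω n => Z n ω) P ∧ (∀ᵐ ω ∂P, ∀ n, 0 < T n ω) ∧
      ∀ᵐ ω ∂P, ∀ (t : ℝ≥0) (n : ℕ), n ≤ N t ω ↔ ∑ k ∈ Finset.range n, T k ω ≤ (t : ℝ) := by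
  obtain ⟨T, hTm, hTi, hTl, hTN⟩ := h.poisson.exists_interarrival
  have hpos : ∀ᵐ ω ∂P, ∀ n, 0 < T n ω := by
    rw [ae_all_iff]
    intro n
    refine ae_of_ae_map (hTm n).aemeasurable ?_
    rw [hTl n]
    exact ae_pos_expMeasure α
  refine ⟨T, hTm, hTi, hTl, ?_, hpos, hTN⟩
  -- The model gives independence of the claims from N only, not from T. The interarrival times are
  -- almost surely this measurable function of the path of N, so the independence transfers.
  have hg : Measurable fun (f : ℝ≥0 → ℕ) (n : ℕ) =>
      (arrivalTime (n + 1) f).toReal - (arrivalTime n f).toReal :=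
    measurable_pi_lambda _ fun n => (measurable_arrivalTime (n + 1)).ennreal_toReal.sub
      (measurable_arrivalTime n).ennreal_toReal
  refine (h.indep.comp hg measurable_id).congr ?_ (ae_eq_refl _)
  filter_upwards [hpos, hTN] with ω hω hN
  ext n
  have hval : ∀ n, (arrivalTime n fun t => N t ω).toReal = ∑ k ∈ Finset.range n, T k ω := fun n =>
    arrivalTime_toReal (Finset.sum_nonneg fun k _ => (hω k).le) fun t => hN t n
  simp only [Function.comp_apply, hval, Finset.sum_range_succ, add_sub_cancel_left]

variable [IsProbabilityMeasure P]

/-- The ruin event has the law of the event that the associated random walk exceeds `x`. -/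
theorem IsRiskModel.nullMeasurableSet_and_measureReal_isRuined (h : IsRiskModel P α c N Z) (x : ℝ) :
    NullMeasurableSet {ω | IsRuined c x N Z ω} P ∧
      P.real {ω | IsRuined c x N Z ω} = 1 - survivalProb (expMeasure α) (P.map (Z 0)) c x := by
  obtain ⟨T, hTm, hTi, hTl, hind, hpos, hN⟩ := h.exists_interarrival_indep
  have hZm := h.claim_measurable
  have := Measure.isProbabilityMeasure_map (μ := P) (hZm 0).aemeasurable
  have := isProbabilityMeasure_expMeasure h.poisson.intensity_pos
  have hZnn : ∀ᵐ ω ∂P, ∀ k, 0 ≤ Z k ω := ae_all_iff.2 h.claim_nonneg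
  have hpm : Measurable fun ω => ((fun n => T n ω), fun n => Z n ω) :=
    (measurable_pi_lambda _ hTm).prodMk (measurable_pi_lambda _ hZm)
  have hmap : P.map (fun ω => ((fun n => T n ω), fun n => Z n ω)) =
      (Measure.infinitePi fun _ : ℕ => expMeasure α).prod
        (Measure.infinitePi fun _ : ℕ => P.map (Z 0)) := by
    rw [hind.map_prod_eq_prod_map_map (measurable_pi_lambda _ hTm).aemeasurable
      (measurable_pi_lambda _ hZm).aemeasurable, hTi.map_fun_eq_infinitePi_map hTm,
      h.claim_iIndep.map_fun_eq_infinitePi_map hZm]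
    simp_rw [hTl, (h.claim_identDistrib _).map_eq]
  set A : Set Ω := (fun ω => ((fun n => T n ω), fun n => Z n ω)) ⁻¹' survivalSet c x with hA
  have hms : MeasurableSet A := hpm (measurableSet_survivalSet c x)
  have hae : {ω | IsRuined c x N Z ω} =ᵐ[P] (Aᶜ : Set Ω) := by
    filter_upwards [hZnn, hpos, hN] with ω h1 h2 h3
    exact propext (isRuined_iff (c := c) (T := fun n => T n ω) h.premium_pos h1 h2 h3)
  refine ⟨hms.compl.nullMeasurableSet.congr hae.symm, ?_⟩
  rw [measureReal_congr hae, probReal_compl_eq_one_sub hms, survivalProb, ← hmap,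
    map_measureReal_apply hpm (measurableSet_survivalSet c x)]

end

/-! ### Two companies along a direction -/

/-- The speed at which the initial capital of each company grows in the direction `(1, q)`. -/
noncomputable def dirWeight (q : ℝ) : Fin 2 → ℝ := ![1, q]

theorem dirWeight_pos {q : ℝ} (hq : 0 < q) (j : Fin 2) : 0 < dirWeight q j := by
  fin_cases j <;> simp [dirWeight, hq]

theorem dirExponent_eq (q : ℝ) (κ : Fin 2 → ℝ) (z₁ : Fin 2 → ℂ) (j k : Fin 2) :
    dirExponent q κ z₁ (j, k) = dirWeight q j * ruinExponent (κ j) (z₁ j) k := by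
  fin_cases j <;> simp [dirExponent, dirWeight]

theorem dirExponent_zero (q : ℝ) (κ : Fin 2 → ℝ) (z₁ : Fin 2 → ℂ) (j : Fin 2) :
    dirExponent q κ z₁ (j, 0) = ((dirWeight q j * κ j : ℝ) : ℂ) := by
  rw [dirExponent_eq]; simp [ruinExponent]

theorem dirExponent_one_re (q : ℝ) (κ : Fin 2 → ℝ) (z₁ : Fin 2 → ℂ) (j : Fin 2) :
    (dirExponent q κ z₁ (j, 1)).re = dirWeight q j * (κ j + (z₁ j).re) := by
  rw [dirExponent_eq]; simp [ruinExponent]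

theorem tendsto_mul_exp_neg_mul_atTop (K : ℝ) {a : ℝ} (ha : 0 < a) :
    Tendsto (fun x : ℝ => K * Real.exp (-a * x)) atTop (𝓝 0) := by
  have : Tendsto (fun x : ℝ => -a * x) atTop atBot :=
    tendsto_id.const_mul_atTop_of_neg (neg_lt_zero.2 ha)
  simpa using (Real.tendsto_exp_atBot.comp this).const_mul K

/-- The limsup is taken in `EReal`, where no boundedness has to be checked for the comparison. -/
theorem limsup_abs_le_one_of_le {η δ : ℝ → ℝ} {C : ℝ} (hC : C ≤ 1) (hδ : Tendsto δ atTop (𝓝 0))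
    (h : ∀ x, 0 ≤ x → |η x| ≤ C + δ x) :
    0 ≤ limsup (fun x => ((|η x| : ℝ) : EReal)) atTop ∧
      limsup (fun x => ((|η x| : ℝ) : EReal)) atTop ≤ 1 := by
  constructor
  · exact le_limsup_of_frequently_le (Eventually.of_forall fun x => by
      exact_mod_cast abs_nonneg (η x)).frequently
  · have ht : Tendsto (fun x => ((C + δ x : ℝ) : EReal)) atTop (𝓝 ((C : ℝ) : EReal)) := by
      have := (continuous_coe_real_ereal.tendsto (C + 0)).comp (hδ.const_add C)
      rw [add_zero] at this
      exact this
    refine (limsup_le_limsup ?_).trans (ht.limsup_eq.le.trans (by exact_mod_cast hC))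
    filter_upwards [eventually_ge_atTop 0] with x hx
    exact_mod_cast h x hx

section

variable {Ω : Type*} [MeasurableSpace Ω] {P : Measure Ω} {α c : Fin 2 → ℝ}
  {N : Fin 2 → ℝ≥0 → Ω → ℕ} {Z : Fin 2 → ℕ → Ω → ℝ} {κ r : Fin 2 → ℝ} {z₁ : Fin 2 → ℂ} {q : ℝ}

/-- The term of the expansion along the direction `(1, q)` with index `i`. -/
noncomputable def dirTerm (P : Measure Ω) (α c : Fin 2 → ℝ) (Z : Fin 2 → ℕ → Ω → ℝ) (κ : Fin 2 → ℝ)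
    (z₁ : Fin 2 → ℂ) (q : ℝ) (i : Fin 2 × Fin 2) (x : ℝ) : ℝ :=
  (dirCoeff P α c Z κ z₁ i * Complex.exp (-dirExponent q κ z₁ i * x)).re

theorem abs_dirTerm_le (i : Fin 2 × Fin 2) (x : ℝ) :
    |dirTerm P α c Z κ z₁ q i x| ≤
      ‖dirCoeff P α c Z κ z₁ i‖ * Real.exp (-(dirExponent q κ z₁ i).re * x) := by
  refine (Complex.abs_re_le_norm _).trans_eq ?_
  rw [norm_mul, Complex.norm_exp]
  simp

/-- The event that company `j` is ruined, along the direction `(1, q)`. -/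
def dirRuin (c : Fin 2 → ℝ) (N : Fin 2 → ℝ≥0 → Ω → ℕ) (Z : Fin 2 → ℕ → Ω → ℝ) (q x : ℝ)
    (j : Fin 2) : Set Ω :=
  {ω | IsRuined (c j) (dirWeight q j * x) (N j) (Z j) ω}

variable [IsProbabilityMeasure P]

theorem ruinProbOr_eq (hmodel : ∀ j, IsRiskModel P (α j) (c j) (N j) (Z j)) {j j' : Fin 2}
    (hne : j ≠ j') (x : ℝ) :
    ruinProbOr P c N Z x (q * x) = P.real (dirRuin c N Z q x j) + P.real (dirRuin c N Z q x j') -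
      P.real (dirRuin c N Z q x j ∩ dirRuin c N Z q x j') := by
  have hU : {ω | IsRuined (c 0) x (N 0) (Z 0) ω ∨ IsRuined (c 1) (q * x) (N 1) (Z 1) ω} =
      dirRuin c N Z q x j ∪ dirRuin c N Z q x j' := by
    have h01 : {ω | IsRuined (c 0) x (N 0) (Z 0) ω ∨ IsRuined (c 1) (q * x) (N 1) (Z 1) ω} =
        dirRuin c N Z q x 0 ∪ dirRuin c N Z q x 1 := by
      ext ω
      simp [dirRuin, dirWeight]
    fin_cases j <;> fin_cases j'
    · exact absurd rfl hne
    · exact h01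
    · exact h01.trans (Set.union_comm _ _)
    · exact absurd rfl hne
  rw [ruinProbOr, hU, eq_sub_iff_add_eq]
  exact measureReal_union_add_inter₀
    ((hmodel j').nullMeasurableSet_and_measureReal_isRuined _).1

/-- The two-term expansion of the ruin probability of company `j` along the direction `(1, q)`. -/
theorem exists_dirRuin_expansion (hmodel : ∀ j, IsRiskModel P (α j) (c j) (N j) (Z j))
    (hκ_pos : ∀ j, 0 < κ j) (hκ : ∀ j, lundbergTransform P (α j) (c j) (Z j 0) (κ j) = 1)
    (hlight : ∀ j, ∀ s : ℝ, s < κ j + r j → Integrable (fun ω => Real.exp (s * Z j 0 ω)) P)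
    (hz₁ : ∀ j, z₁ j ≠ 0)
    (hroots : ∀ j, {z : ℂ | 0 ≤ z.re ∧ z.re < r j ∧
        tiltedMGF P (α j) (c j) (Z j 0) (κ j) z = 1} = {0, z₁ j, conj (z₁ j)})
    (hsimple : ∀ j, deriv (tiltedMGF P (α j) (c j) (Z j 0) (κ j)) (z₁ j) ≠ 0) (hq : 0 < q) (j : Fin 2) :
    ∃ B K : ℝ, (dirExponent q κ z₁ (j, 1)).re < B ∧ ∀ x : ℝ, 0 ≤ x →
      |P.real (dirRuin c N Z q x j) -
        (dirTerm P α c Z κ z₁ q (j, 0) x + dirTerm P α c Z κ z₁ q (j, 1) x)| ≤ K * Real.exp (-B * x) := by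
  have hm := hmodel j
  obtain ⟨b, K, hb, h⟩ := exists_abs_ruin_sub_le hm.poisson.intensity_pos hm.premium_pos
    (hm.claim_measurable 0) (hm.claim_nonneg 0) hm.claim_integrable hm.drift_pos (hκ_pos j) (hκ j)
    (hlight j) (hz₁ j) (hroots j) (hsimple j)
  have hw := dirWeight_pos hq j
  refine ⟨dirWeight q j * b, K, ?_, fun x hx => ?_⟩
  · rw [dirExponent_one_re]; exact mul_lt_mul_of_pos_left hb hw
  · have := h (dirWeight q j * x) (mul_nonneg hw.le hx)
    rw [dirRuin, (hm.nullMeasurableSet_and_measureReal_isRuined _).2]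
    convert this using 3
    · simp only [dirTerm, dirCoeff, dirExponent_eq]
      congr 4 <;> push_cast <;> ring
    · ring

theorem root_re_pos (hmodel : ∀ j, IsRiskModel P (α j) (c j) (N j) (Z j))
    (hκ_pos : ∀ j, 0 < κ j) (hκ : ∀ j, lundbergTransform P (α j) (c j) (Z j 0) (κ j) = 1)
    (hlight : ∀ j, ∀ s : ℝ, s < κ j + r j → Integrable (fun ω => Real.exp (s * Z j 0 ω)) P)
    (hz₁ : ∀ j, z₁ j ≠ 0)
    (hroots : ∀ j, {z : ℂ | 0 ≤ z.re ∧ z.re < r j ∧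
        tiltedMGF P (α j) (c j) (Z j 0) (κ j) z = 1} = {0, z₁ j, conj (z₁ j)}) (j : Fin 2) :
    0 < (z₁ j).re := by
  have hm := hmodel j
  obtain ⟨hre, hrer, h1⟩ : z₁ j ∈ {z : ℂ | 0 ≤ z.re ∧ z.re < r j ∧
      tiltedMGF P (α j) (c j) (Z j 0) (κ j) z = 1} := by rw [hroots j]; simp
  exact (root_re_pos_im_ne (div_pos hm.poisson.intensity_pos hm.premium_pos) (hm.claim_measurable 0)
    (hm.claim_nonneg 0) (hκ_pos j) (hκ j) (hlight j) (hz₁ j) hre hrer h1).1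

/-- The expansion of the joint ruin probability when company `j` has the smallest exponent. -/
theorem exists_dominant_expansion (hmodel : ∀ j, IsRiskModel P (α j) (c j) (N j) (Z j))
    (hκ_pos : ∀ j, 0 < κ j) (hκ : ∀ j, lundbergTransform P (α j) (c j) (Z j 0) (κ j) = 1)
    (hr : ∀ j, 0 < r j)
    (hlight : ∀ j, ∀ s : ℝ, s < κ j + r j → Integrable (fun ω => Real.exp (s * Z j 0 ω)) P)
    (hz₁ : ∀ j, z₁ j ≠ 0)
    (hroots : ∀ j, {z : ℂ | 0 ≤ z.re ∧ z.re < r j ∧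
        tiltedMGF P (α j) (c j) (Z j 0) (κ j) z = 1} = {0, z₁ j, conj (z₁ j)})
    (hsimple : ∀ j, deriv (tiltedMGF P (α j) (c j) (Z j 0) (κ j)) (z₁ j) ≠ 0) (hq : 0 < q)
    {j j' : Fin 2} (hne : j ≠ j') (hlt : dirWeight q j * κ j < dirWeight q j' * κ j') :
    ∃ (i₁ : Fin 2 × Fin 2) (η : ℝ → ℝ), (j, 0) ≠ i₁ ∧
      dirWeight q j * κ j < (dirExponent q κ z₁ i₁).re ∧
      (∀ i, i ≠ (j, 0) → i ≠ i₁ → (dirExponent q κ z₁ i₁).re ≤ (dirExponent q κ z₁ i).re) ∧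
      (∀ x : ℝ, 0 ≤ x → ruinProbOr P c N Z x (q * x) = dirTerm P α c Z κ z₁ q (j, 0) x +
        dirTerm P α c Z κ z₁ q i₁ x + η x * Real.exp (-(dirExponent q κ z₁ i₁).re * x)) ∧
      0 ≤ limsup (fun x => ((|η x| : ℝ) : EReal)) atTop ∧
      limsup (fun x => ((|η x| : ℝ) : EReal)) atTop ≤ 1 := by
  have hpos := root_re_pos hmodel hκ_pos hκ hlight hz₁ hroots
  have hexp := exists_dirRuin_expansion hmodel hκ_pos hκ hlight hz₁ hroots hsimple hq
  obtain ⟨B, K, hB, hK⟩ := hexp j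
  obtain ⟨B', K', hB', hK'⟩ := hexp j'
  have hm' := hmodel j'
  obtain ⟨C₀, hC₀, hC₀pos, hC₀le⟩ := exists_ruinResidue_adjustment hm'.poisson.intensity_pos
    hm'.premium_pos (hm'.claim_measurable 0) (hm'.claim_nonneg 0) hm'.claim_integrable hm'.drift_pos
    (hκ_pos j') (hκ j') (hr j') (hlight j')
  have hstep : ∀ j, dirWeight q j * κ j < (dirExponent q κ z₁ (j, 1)).re := fun j => by
    rw [dirExponent_one_re]
    exact mul_lt_mul_of_pos_left (by linarith [hpos j]) (dirWeight_pos hq j)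
  have hzero_re : ∀ j, (dirExponent q κ z₁ (j, 0)).re = dirWeight q j * κ j := fun j => by
    rw [dirExponent_zero, Complex.ofReal_re]
  set e := dirWeight q j * κ j with he
  set e' := dirWeight q j' * κ j' with he'
  set f := (dirExponent q κ z₁ (j, 1)).re with hf
  set f' := (dirExponent q κ z₁ (j', 1)).re with hf'
  have hT0' : ∀ x, dirTerm P α c Z κ z₁ q (j', 0) x = C₀ * Real.exp (-e' * x) := fun x => by
    rw [dirTerm, dirExponent_zero, ← he']
    have : dirCoeff P α c Z κ z₁ (j', 0) = C₀ := by simpa [dirCoeff, ruinCoeff] using hC₀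
    rw [this, ← Complex.ofReal_neg, ← Complex.ofReal_mul, ← Complex.ofReal_exp, ← Complex.ofReal_mul,
      Complex.ofReal_re]
  set M := ‖dirCoeff P α c Z κ z₁ (j, 1)‖ with hM
  set M' := ‖dirCoeff P α c Z κ z₁ (j', 1)‖ with hM'
  have hT1 : ∀ x, |dirTerm P α c Z κ z₁ q (j, 1) x| ≤ M * Real.exp (-f * x) := abs_dirTerm_le _
  have hT1' : ∀ x, |dirTerm P α c Z κ z₁ q (j', 1) x| ≤ M' * Real.exp (-f' * x) := abs_dirTerm_le _
  have hstepj' : e' < f' := hstep j'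
  have hcases : ∀ k : Fin 2, k = j ∨ k = j' := fun k => by
    fin_cases j <;> fin_cases j' <;> fin_cases k <;> simp_all
  have hcases01 : ∀ k : Fin 2, k = 0 ∨ k = 1 := fun k => by fin_cases k <;> simp
  have hunion := ruinProbOr_eq (q := q) hmodel hne
  have hI0 : ∀ x, 0 ≤ P.real (dirRuin c N Z q x j ∩ dirRuin c N Z q x j') := fun x => measureReal_nonneg
  have hI1 : ∀ x, P.real (dirRuin c N Z q x j ∩ dirRuin c N Z q x j') ≤
      P.real (dirRuin c N Z q x j') := fun x => measureReal_mono Set.inter_subset_right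
  have hscale : ∀ a b x : ℝ, Real.exp (-a * x) * Real.exp (b * x) = Real.exp (-(a - b) * x) :=
    fun a b x => by rw [← Real.exp_add]; ring_nf
  -- A tie f = e' is resolved in favour of the second term of j. In the other choice that term would
  -- remain in η, and its coefficient has no bound by 1.
  by_cases hfe : f ≤ e'
  · refine ⟨(j, 1), fun x => (ruinProbOr P c N Z x (q * x) - dirTerm P α c Z κ z₁ q (j, 0) x -
      dirTerm P α c Z κ z₁ q (j, 1) x) * Real.exp (f * x), by simp, hstep j, ?_, fun x hx => ?_,
      limsup_abs_le_one_of_le hC₀le (δ := fun x => K * Real.exp (-(B - f) * x) +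
        M' * Real.exp (-(f' - f) * x) + K' * Real.exp (-(B' - f) * x)) ?_ fun x hx => ?_⟩
    · rintro ⟨k, l⟩ h1 h2
      rcases hcases k with rfl | rfl
      · rcases hcases01 l with rfl | rfl
        · exact absurd rfl h1
        · exact absurd rfl h2
      · rcases hcases01 l with rfl | rfl
        · rw [hzero_re]; exact hfe
        · exact hfe.trans hstepj'.le
    · rw [mul_assoc, ← Real.exp_add, ← hf, show f * x + -f * x = 0 by ring, Real.exp_zero]
      ring
    · have := ((tendsto_mul_exp_neg_mul_atTop K (sub_pos.2 hB)).add
        (tendsto_mul_exp_neg_mul_atTop M' (sub_pos.2 (hfe.trans_lt hstepj')))).add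
        (tendsto_mul_exp_neg_mul_atTop K' (sub_pos.2 (hfe.trans_lt (hstepj'.trans hB'))))
      simpa using this
    · have hE := Real.exp_pos (f * x)
      -- The ruin probability of j' minus the intersection lies between 0 and the ruin probability
      -- of j', so C₀ and the errors of j' enter once.
      have h1 : |ruinProbOr P c N Z x (q * x) - dirTerm P α c Z κ z₁ q (j, 0) x -
          dirTerm P α c Z κ z₁ q (j, 1) x| ≤ C₀ * Real.exp (-e' * x) + (K * Real.exp (-B * x) +
            M' * Real.exp (-f' * x) + K' * Real.exp (-B' * x)) := by
        have a1 := abs_le.1 (hK x hx)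
        have a2 := abs_le.1 (hK' x hx)
        have a3 := abs_le.1 (hT1' x)
        have a4 := hT0' x
        have a5 := hI0 x
        have a6 := hI1 x
        have a7 : 0 ≤ P.real (dirRuin c N Z q x j') := measureReal_nonneg
        rw [hunion x, abs_le]
        constructor <;> linarith [a1.1, a1.2, a2.1, a2.2, a3.1, a3.2]
      rw [abs_mul, abs_of_pos hE]
      refine (mul_le_mul_of_nonneg_right h1 hE.le).trans ?_
      simp only [add_mul, mul_assoc, hscale]
      have h2 : C₀ * Real.exp (-(e' - f) * x) ≤ C₀ := by
        refine mul_le_of_le_one_right hC₀pos.le (Real.exp_le_one_iff.2 ?_)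
        nlinarith
      linarith
  · push Not at hfe
    refine ⟨(j', 0), fun x => (ruinProbOr P c N Z x (q * x) - dirTerm P α c Z κ z₁ q (j, 0) x -
      dirTerm P α c Z κ z₁ q (j', 0) x) * Real.exp (e' * x), by simpa using hne,
      by rw [hzero_re]; exact hlt, ?_, fun x hx => ?_,
      limsup_abs_le_one_of_le hC₀le (δ := fun x => K * Real.exp (-(B - e') * x) +
        M * Real.exp (-(f - e') * x) + 2 * M' * Real.exp (-(f' - e') * x) +
          2 * K' * Real.exp (-(B' - e') * x)) ?_ fun x hx => ?_⟩
    · rw [hzero_re]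
      rintro ⟨k, l⟩ h1 h2
      rcases hcases k with rfl | rfl
      · rcases hcases01 l with rfl | rfl
        · exact absurd rfl h1
        · exact hfe.le
      · rcases hcases01 l with rfl | rfl
        · exact absurd rfl h2
        · exact hstepj'.le
    · rw [hzero_re, mul_assoc, ← Real.exp_add, ← he', show e' * x + -e' * x = 0 by ring, Real.exp_zero]
      ring
    · have := (((tendsto_mul_exp_neg_mul_atTop K (sub_pos.2 (hfe.trans hB))).add
        (tendsto_mul_exp_neg_mul_atTop M (sub_pos.2 hfe))).add
        (tendsto_mul_exp_neg_mul_atTop (2 * M') (sub_pos.2 hstepj'))).add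
        (tendsto_mul_exp_neg_mul_atTop (2 * K') (sub_pos.2 (hstepj'.trans hB')))
      simpa using this
    · have hE := Real.exp_pos (e' * x)
      -- The errors of j' count twice, once from its own expansion and once from bounding the
      -- intersection by its ruin probability. Its leading term has been subtracted in the
      -- expansion, so C₀ enters only through the intersection.
      have h1 : |ruinProbOr P c N Z x (q * x) - dirTerm P α c Z κ z₁ q (j, 0) x -
          dirTerm P α c Z κ z₁ q (j', 0) x| ≤ C₀ * Real.exp (-e' * x) + (K * Real.exp (-B * x) +
            M * Real.exp (-f * x) + 2 * M' * Real.exp (-f' * x) + 2 * K' * Real.exp (-B' * x)) := by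
        have a1 := abs_le.1 (hK x hx)
        have a2 := abs_le.1 (hK' x hx)
        have a3 := abs_le.1 (hT1' x)
        have a3' := abs_le.1 (hT1 x)
        have a4 := hT0' x
        have a5 := hI0 x
        have a6 := hI1 x
        have a8 : 0 ≤ C₀ * Real.exp (-e' * x) := mul_nonneg hC₀pos.le (Real.exp_pos _).le
        rw [hunion x, abs_le]
        constructor <;> linarith [a1.1, a1.2, a2.1, a2.2, a3.1, a3.2, a3'.1, a3'.2]
      rw [abs_mul, abs_of_pos hE]
      refine (mul_le_mul_of_nonneg_right h1 hE.le).trans ?_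
      simp only [add_mul, mul_assoc, hscale]
      have h2 : Real.exp (-(e' - e') * x) = 1 := by simp
      rw [h2, mul_one]

end

theorem mainTheorem8 {Ω : Type*} [MeasurableSpace Ω] (P : Measure Ω) [IsProbabilityMeasure P]
    (α c : Fin 2 → ℝ) (N : Fin 2 → ℝ≥0 → Ω → ℕ) (Z : Fin 2 → ℕ → Ω → ℝ)
    (hmodel : ∀ j, IsRiskModel P (α j) (c j) (N j) (Z j))
    -- the adjustment coefficients: positive real solutions of the Lundberg equations
    (κ : Fin 2 → ℝ) (hκ_pos : ∀ j, 0 < κ j)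
    (hκ : ∀ j, lundbergTransform P (α j) (c j) (Z j 0) (κ j) = 1)
    -- light tails: the transforms converge on the strips considered below
    (r : Fin 2 → ℝ) (hr : ∀ j, 0 < r j)
    (hlight : ∀ j, ∀ s : ℝ, s < κ j + r j → Integrable (fun ω => Real.exp (s * Z j 0 ω)) P)
    -- in the strip, the roots of `g_j(z) = 1` are exactly `0`, `z₁ j`, `conj (z₁ j)`, and
    -- the last two are simple
    (z₁ : Fin 2 → ℂ) (hz₁ : ∀ j, z₁ j ≠ 0)
    (hroots : ∀ j, {z : ℂ | 0 ≤ z.re ∧ z.re < r j ∧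
        tiltedMGF P (α j) (c j) (Z j 0) (κ j) z = 1} = {0, z₁ j, conj (z₁ j)})
    (hsimple : ∀ j, deriv (tiltedMGF P (α j) (c j) (Z j 0) (κ j)) (z₁ j) ≠ 0)
    -- the direction
    (q : ℝ) (hq : 0 < q) (hqκ : q * κ 1 ≠ κ 0) :
    ∃ (i₀ i₁ : Fin 2 × Fin 2) (d₀ : ℝ) (d₁ : ℂ) (D₀ D₁ : ℂ) (η : ℝ → ℝ),
      -- the two terms are the two dominant ones among the four one-dimensional terms
      i₀ ≠ i₁ ∧
      (d₀ : ℂ) = dirExponent q κ z₁ i₀ ∧ D₀ = dirCoeff P α c Z κ z₁ i₀ ∧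
      d₁ = dirExponent q κ z₁ i₁ ∧ D₁ = dirCoeff P α c Z κ z₁ i₁ ∧
      0 < d₀ ∧ d₀ < d₁.re ∧
      (∀ i, i ≠ i₀ → i ≠ i₁ → d₁.re ≤ (dirExponent q κ z₁ i).re) ∧
      -- the expansion
      (∀ x : ℝ, 0 ≤ x →
        ruinProbOr P c N Z x (q * x) =
          (D₀ * Complex.exp (-d₀ * x)).re + (D₁ * Complex.exp (-d₁ * x)).re +
            η x * Real.exp (-d₁.re * x)) ∧
      0 ≤ limsup (fun x => ((|η x| : ℝ) : EReal)) atTop ∧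
      limsup (fun x => ((|η x| : ℝ) : EReal)) atTop ≤ 1 := by
  have h0 : dirWeight q 0 * κ 0 = κ 0 := by simp [dirWeight]
  have h1 : dirWeight q 1 * κ 1 = q * κ 1 := by simp [dirWeight]
  -- The assumption q κ₂ ≠ κ₁ makes one of the two real exponents strictly smaller, and the rest is
  -- symmetric in the companies.
  obtain ⟨j, j', hne, hlt⟩ : ∃ j j' : Fin 2, j ≠ j' ∧
      dirWeight q j * κ j < dirWeight q j' * κ j' := by
    rcases lt_or_gt_of_ne hqκ with h | h
    · exact ⟨1, 0, by decide, by rwa [h0, h1]⟩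
    · exact ⟨0, 1, by decide, by rwa [h0, h1]⟩
  obtain ⟨i₁, η, hi, hlt₁, hdom, hexp, hlim⟩ :=
    exists_dominant_expansion hmodel hκ_pos hκ hr hlight hz₁ hroots hsimple hq hne hlt
  refine ⟨(j, 0), i₁, dirWeight q j * κ j, dirExponent q κ z₁ i₁, dirCoeff P α c Z κ z₁ (j, 0),
    dirCoeff P α c Z κ z₁ i₁, η, hi, (dirExponent_zero q κ z₁ j).symm, rfl, rfl, rfl,
    mul_pos (dirWeight_pos hq j) (hκ_pos j), hlt₁, hdom, fun x hx => ?_, hlim⟩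
  rw [hexp x hx, dirTerm, dirTerm, dirExponent_zero]
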